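/- Let $K$ be a field, $S=K[x_0,\dots,x_n]$ with $x_0<\dots<x_n$, and let $J\subseteq S$ be a strongly stable monomial ideal that is an $m$-truncation for some $m\in\mathbb N$, that is $J=(J^{\mathrm{sat}})_{\ge m}$. (Strongly stable: if $x^\alpha\in J$, $x_i\mid x^\alpha$ and $i<j$, then $x^\alpha x_j/x_i\in J$.) **Notation.** $B_J$ is the set of minimal monomial generators of $J$; $\mathcal N(J)$ is the set of monomials outside $J$, and $\mathcal N(J)_d$ its part of degree $d$. $x^{\underline\alpha}$ is $x^\alpha$ with $x_0$ replaced by $1$; $\underline J$ is the ideal generated by the $x^{\underline\alpha}$, $x^\alpha\in B_J$; $sB_J=\{x^\alpha\in B_J : x^{\underline\alpha}\in B_{\underline J}\}$ is the set of superminimal generators. For a monomial ideal $I$ write $x^\gamma=x^\alpha *_I x^\eta$ if $x^\gamma=x^\alpha x^\eta$, $x^\alpha\in B_I$ and every variable dividing $x^\eta$ is $\le$ every variable dividing $x^\alpha$. $\mathrm{Mf}(J)$ is the set of homogeneous ideals $I\subseteq S$ such that $\mathcal N(J)$ is a $K$-basis of $S/I$. Let $C=\{C_{\alpha\gamma} :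 x^\alpha\in B_J,\ x^\gamma\in\mathcal N(J)_{|\alpha|}\}$ be new variables, $\widetilde C\subseteq C$ those with $x^\alpha\in sB_J$, $F_\alpha=x^\alpha-\sum_\gamma C_{\alpha\gamma}x^\gamma$ with head term $x^\alpha$, $\mathcal G=\{F_\alpha : x^\alpha\in B_J\}$ and $s\mathcal G=\{F_\alpha : x^\alpha\in sB_J\}$. With $\mathrm{lcm}(x^\alpha,x^{\alpha'})=x^\gamma x^\alpha=x^{\gamma'}x^{\alpha'}$ put $S(F_\alpha,F_{\alpha'})=x^\gamma F_\alpha-x^{\gamma'}F_{\alpha'}$. Let $\mathfrak A_J\subseteq K[C]$ be the ideal generated by the $x$-coefficients of the reduced forms (all $x$-monomials in $\mathcal N(J)$) of the polynomials $S(F,F')$, $F,F'\in\mathcal G$, obtained by reduction with the polynomials $x^\delta F_\alpha$, $F_\alpha\in\mathcal G$, such that every variable dividing $x^\delta$ is $\le$ every variable dividing $x^\alpha$; it defines the scheme structure of $\mathrm{Mf}(J)$. Put $\widetilde{\mathfrak A}_J=\mathfrak A_J\cap K[\widetilde C]$. A step of *superminimal reduction* of $h\in K[\widetilde C][x]$ replaces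 $h$ by $h-c\,x^\epsilon F_\alpha$, where $F_\alpha\in s\mathcal G$, $x^\gamma=x^\alpha x^\epsilon\in J$ is a monomial of $h$ with coefficient $c\ne0$, and $x^\gamma=x^{\underline\alpha}*_{\underline J}x^\eta$ for some $x^\eta$. $h$ is *strongly reduced* if no $x_0^th$, $t\ge0$, admits such a step. $\textsc{superminimalReduction}(H)$ returns $(t,h)$, where $t$ is minimal such that zero or more steps lead from $x_0^tH$ to a strongly reduced polynomial, and $h$ is such a polynomial; it is executed by trying $t=0,1,2,\dots$, performing for each $t$ arbitrary steps on $x_0^tH$ until none is possible, and stopping as soon as a strongly reduced polynomial is reached. **The algorithm markedScheme$(J)$.** (0) Build $s\mathcal G$ and let $\widetilde{\mathcal G}=s\mathcal G$, $E=\emptyset$. (1) For every $x^\alpha\in B_J\setminus sB_J$, let $(t,H)=\textsc{superminimalReduction}(x^\alpha)$, write $H=H'+x_0^tH''$ with no monomial of $H'$ divisible by $x_0^t$, add the $x$-coefficients of $H'$ to $E$ and $x^\alpha-H''$ to $\widetilde{\mathcal G}$. (2) For every pair in $$L_1=\{(F_\alpha,F_{\alpha'}) : F_\alpha,F_{\alpha'}\in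 s\mathcal G,\ x_ix^{\underline\alpha}=x^{\underline{\alpha'}}*_{\underline J}x^\eta\text{ for some } i \text{ and } x^\eta\},$$ let $(t,H)=\textsc{superminimalReduction}(S(F_\alpha,F_{\alpha'}))$ and add the $x$-coefficients of $H$ to $E$. Return $E\subseteq K[\widetilde C]$. **Theorem.** The algorithm is correct. For every order in which the loops are processed and every choice of the reduction steps, it terminates (there is no infinite run, and a run stops only by returning), each of its calls of $\textsc{superminimalReduction}$ ends with a pair as prescribed above, and the returned set $E$ is finite and generates $\widetilde{\mathfrak A}_J$. This ideal defines $\mathrm{Mf}(J)$: the inclusion $K[\widetilde C]\subseteq K[C]$ induces a surjection $K[\widetilde C]\to K[C]/\mathfrak A_J$ (hence $K[\widetilde C]/\widetilde{\mathfrak A}_J\cong K[C]/\mathfrak A_J$); for every zero $c\in K^{\widetilde C}$ of $\widetilde{\mathfrak A}_J$ there is exactly one $I\in\mathrm{Mf}(J)$ that contains all the specializations $F_\alpha(c)$, $F_\alpha\in s\mathcal G$; and every $I\in\mathrm{Mf}(J)$ arises in this way from exactly one zero $c$ of $\widetilde{\mathfrak A}_J$. -/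

import Mathlib

open MvPolynomial

noncomputable section

namespace MarkedScheme

/-- Exponents of the monomials in the variables `x_0 < x_1 < ... < x_n`. -/
abbrev Exp (n : ℕ) := Fin (n + 1) →₀ ℕ

/-- Polynomials in `x_0, ..., x_n` with coefficients in `A`. -/
abbrev Poly (n : ℕ) (A : Type*) [CommRing A] := MvPolynomial (Fin (n + 1)) A

section MonomialIdeals

variable {n : ℕ} {K : Type*} [Field K]

/-- `J` is generated by monomials. -/
def IsMonomialIdeal (J : Ideal (Poly n K)) : Prop :=
  ∃ s : Set (Exp n), J = Ideal.span ((fun α => monomial α (1 : K)) '' s)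

/-- `x^β = e⁺_{i,j}(x^α)` for some `i < j`, that is `x^α x_j = x^β x_i`. -/
def IncreasingMove (α β : Exp n) : Prop :=
  ∃ i j : Fin (n + 1), i < j ∧ α + Finsupp.single j 1 = β + Finsupp.single i 1

/-- `BorelLT α β` means `x^α <_B x^β` in the Borel partial order. -/
def BorelLT (α β : Exp n) : Prop := Relation.TransGen IncreasingMove α β

/-- Every monomial that is Borel-greater than a monomial of `J` belongs to `J`. -/
def IsStronglyStable (J : Ideal (Poly n K)) : Prop :=
  ∀ α β : Exp n, monomial α (1 : K) ∈ J → BorelLT α β → monomial β (1 : K) ∈ J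

/-- The saturation of `J` with respect to the irrelevant ideal. -/
def saturation (J : Ideal (Poly n K)) : Set (Poly n K) :=
  {f | ∀ j : Fin (n + 1), ∃ r : ℕ, X j ^ r * f ∈ J}

/-- `J = (J^sat)_{≥ m}`. -/
def IsTruncation (m : ℕ) (J : Ideal (Poly n K)) : Prop :=
  ∀ f : Poly n K, f ∈ J ↔ f ∈ saturation J ∧ ∀ γ ∈ f.support, m ≤ γ.degree

/-- The minimal monomial generators `B_J` of a monomial ideal. -/
def monomialBasis (J : Ideal (Poly n K)) : Set (Exp n) :=
  {α | monomial α (1 : K) ∈ J ∧ ∀ β : Exp n, monomial β (1 : K) ∈ J → β ≤ α → β = α}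

/-- The sous-escalier `N(J)`: the monomials outside `J`. -/
def sousEscalier (J : Ideal (Poly n K)) : Set (Exp n) :=
  {γ | monomial γ (1 : K) ∉ J}

open Classical in
/-- `N(J)_d`, the monomials of degree `d` outside `J`. -/
def sousEscalierDeg (J : Ideal (Poly n K)) (d : ℕ) : Finset (Exp n) :=
  (Finset.finsuppAntidiag Finset.univ d).filter (fun γ => γ ∈ sousEscalier J)

/-- The exponent of the monomial obtained from `x^α` by putting `x_0 = 1`. -/
def under (α : Exp n) : Exp n := α.erase 0

/-- The ideal generated by the monomials of `B_J` after putting `x_0 = 1`. -/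
def underIdeal (J : Ideal (Poly n K)) : Ideal (Poly n K) :=
  Ideal.span ((fun α => monomial (under α) (1 : K)) '' monomialBasis J)

/-- The superminimal generators `sB_J`. -/
def superminimals (J : Ideal (Poly n K)) : Set (Exp n) :=
  {β | β ∈ monomialBasis J ∧ under β ∈ monomialBasis (underIdeal J)}

/-- `x^γ = x^α *_J x^η`: `x^γ = x^α x^η`, `x^α ∈ B_J` and `min(x^α) ≥ max(x^η)`
(the last condition being void when `x^α = 1` or `x^η = 1`). -/
def IsStar (J : Ideal (Poly n K)) (γ α η : Exp n) : Prop :=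
  γ = α + η ∧ α ∈ monomialBasis J ∧ ∀ i ∈ α.support, ∀ j ∈ η.support, j ≤ i

/-- The marked family `Mf(J)`: the homogeneous ideals `I` such that the monomials outside `J`
form a `K`-basis of the quotient by `I`. -/
def markedFamily (J : Ideal (Poly n K)) : Set (Ideal (Poly n K)) :=
  {I | (∀ f ∈ I, ∀ d : ℕ, homogeneousComponent d f ∈ I) ∧
    LinearIndependent K
      (fun γ : sousEscalier J => Ideal.Quotient.mk I (monomial (γ : Exp n) (1 : K))) ∧
    Submodule.span K (Set.range
      (fun γ : sousEscalier J => Ideal.Quotient.mk I (monomial (γ : Exp n) (1 : K)))) = ⊤}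

end MonomialIdeals

/-- A polynomial together with (the exponent of) its head term. -/
structure Marked (n : ℕ) (A : Type*) [CommRing A] where
  head : Exp n
  poly : Poly n A

section Reductions

variable {n : ℕ} {K : Type*} [Field K] {A : Type*} [CommRing A]

/-- The S-polynomial of two marked polynomials. -/
def sPoly (f g : Marked n A) : Poly n A :=
  monomial ((f.head ⊔ g.head) - f.head) 1 * f.poly -
    monomial ((f.head ⊔ g.head) - g.head) 1 * g.poly

/-- All monomials of `h` lie outside `J`. -/
def IsReduced (J : Ideal (Poly n K)) (h : Poly n A) : Prop :=
  ∀ γ ∈ h.support, γ ∈ sousEscalier J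

/-- One step of reduction by the set `V` of the polynomials `x^δ f_α` with `f_α ∈ G` and
`x^δ = 1` or `max(x^δ) ≤ min(x^α)`. -/
def VStep (G : Set (Marked n A)) (h h₁ : Poly n A) : Prop :=
  ∃ f ∈ G, ∃ δ : Exp n, (∀ i ∈ f.head.support, ∀ j ∈ δ.support, j ≤ i) ∧
    δ + f.head ∈ h.support ∧
    h₁ = h - monomial δ (h.coeff (δ + f.head)) * f.poly

/-- The `sG_*`-relation: a monomial `x^γ ∈ Supp(h) ∩ J` with coefficient `c`,
`x^γ = x^{under α} *_{underIdeal J} x^η = x^α x^ε`, is eliminated by subtracting `c x^ε f_α`. -/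
def SGStep (J : Ideal (Poly n K)) (sG : Set (Marked n A)) (h h₁ : Poly n A) : Prop :=
  ∃ γ ∈ h.support, monomial γ (1 : K) ∈ J ∧
    ∃ f ∈ sG, ∃ η ε : Exp n, IsStar (underIdeal J) γ (under f.head) η ∧ γ = f.head + ε ∧
      h₁ = h - monomial ε (h.coeff γ) * f.poly

/-- Superminimal reduction (zero or more steps). -/
def SGReduces (J : Ideal (Poly n K)) (sG : Set (Marked n A)) : Poly n A → Poly n A → Prop :=
  Relation.ReflTransGen (SGStep J sG)

/-- No step of superminimal reduction can be performed on `h`. -/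
def NonReducible (J : Ideal (Poly n K)) (sG : Set (Marked n A)) (h : Poly n A) : Prop :=
  ∀ h₁, ¬ SGStep J sG h h₁

/-- No `x_0^t h` can be reduced. -/
def StronglyReduced (J : Ideal (Poly n K)) (sG : Set (Marked n A)) (h : Poly n A) : Prop :=
  ∀ t : ℕ, NonReducible J sG (X 0 ^ t * h)

/-- The specification of `superminimalReduction(H, sG) = (t, h)`: `t` is the least exponent such
that `x_0^t H` has a superminimal reduction to a strongly reduced polynomial, and `h` is such a
polynomial. -/
def IsSuperminimalReduction (J : Ideal (Poly n K)) (sG : Set (Marked n A)) (H : Poly n A)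
    (t : ℕ) (h : Poly n A) : Prop :=
  SGReduces J sG (X 0 ^ t * H) h ∧ StronglyReduced J sG h ∧
    ∀ t' : ℕ, ∀ h' : Poly n A, SGReduces J sG (X 0 ^ t' * H) h' → StronglyReduced J sG h' → t ≤ t'

/-- One step of the execution of `superminimalReduction(H, sG)`. The pair `(t, P)` consists of the
current exponent and of a polynomial to which `x_0^t H` has been reduced: an arbitrary reduction
step is performed on `P` as long as possible; if the outcome is not strongly reduced, the
computation is started again with `t + 1`. The execution ends at `(t, P)` when `P` is strongly
reduced. -/
inductive SMRStep (J : Ideal (Poly n K)) (sG : Set (Marked n A)) (H : Poly n A) :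
    ℕ × Poly n A → ℕ × Poly n A → Prop
  | reduce (t : ℕ) (P P' : Poly n A) (h : SGStep J sG P P') : SMRStep J sG H (t, P) (t, P')
  | restart (t : ℕ) (P : Poly n A) (h : NonReducible J sG P) (h' : ¬ StronglyReduced J sG P) :
      SMRStep J sG H (t, P) (t + 1, X 0 ^ (t + 1) * H)

/-- The set `L_1`: the pairs of elements of `sG` such that
`x_i x^{under α} = x^{under α'} *_{underIdeal J} x^η` for some `i` and some `η`. -/
def pairsL1 (J : Ideal (Poly n K)) (sG : Set (Marked n A)) : Set (Marked n A × Marked n A) :=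
  {p | p.1 ∈ sG ∧ p.2 ∈ sG ∧ ∃ (i : Fin (n + 1)) (η : Exp n),
    IsStar (underIdeal J) (Finsupp.single i 1 + under p.1.head) (under p.2.head) η}

end Reductions

section Generic

variable {n : ℕ} {K : Type*} [Field K]

/-- The indices `(α, γ)` of the parameters `C_{αγ}`, with `x^α ∈ B` and `x^γ ∈ N(J)_{|α|}`. -/
def Param (J : Ideal (Poly n K)) (B : Set (Exp n)) : Type :=
  {p : Exp n × Exp n // p.1 ∈ B ∧ p.2 ∈ sousEscalierDeg J p.1.degree}

/-- The parameters `C`. -/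
abbrev ParamC (J : Ideal (Poly n K)) : Type := Param J (monomialBasis J)

/-- The parameters `C̃`. -/
abbrev ParamCt (J : Ideal (Poly n K)) : Type := Param J (superminimals J)

/-- The inclusion of `C̃` in `C`. -/
def inclParam (J : Ideal (Poly n K)) (c : ParamCt J) : ParamC J :=
  ⟨c.1, c.2.1.1, c.2.2⟩

/-- The generic marked polynomial `F_α = x^α - ∑ C_{αγ} x^γ`, the sum being over `N(J)_{|α|}`. -/
def generic (J : Ideal (Poly n K)) (B : Set (Exp n)) (α : Exp n) (hα : α ∈ B) :
    Marked n (MvPolynomial (Param J B) K) where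
  head := α
  poly := monomial α 1 -
    ∑ γ ∈ (sousEscalierDeg J α.degree).attach, monomial γ.1 (X ⟨(α, γ.1), hα, γ.2⟩)

/-- The set of the `F_α` with `x^α ∈ B`; it is `𝒢` for `B = B_J` and `s𝒢` for `B = sB_J`. -/
def genericSet (J : Ideal (Poly n K)) (B : Set (Exp n)) :
    Set (Marked n (MvPolynomial (Param J B) K)) :=
  {F | ∃ (α : Exp n) (hα : α ∈ B), F = generic J B α hα}

/-- The ideal `𝔄_J` of `K[C]`, generated by the `x`-coefficients of the `J`-reduced forms,
obtained by `V`-reduction, of the S-polynomials of the elements of `𝒢`; it defines the scheme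
structure of `Mf(J)`. -/
def idealA (J : Ideal (Poly n K)) : Ideal (MvPolynomial (ParamC J) K) :=
  Ideal.span {c | ∃ F ∈ genericSet J (monomialBasis J), ∃ F' ∈ genericSet J (monomialBasis J),
    ∃ R, Relation.ReflTransGen (VStep (genericSet J (monomialBasis J))) (sPoly F F') R ∧
      IsReduced J R ∧ c ∈ R.coeffs}

/-- The inclusion `K[C̃] → K[C]`. -/
def inclRing (J : Ideal (Poly n K)) :
    MvPolynomial (ParamCt J) K →ₐ[K] MvPolynomial (ParamC J) K :=
  rename (inclParam J)

/-- The ideal `𝔄̃_J = 𝔄_J ∩ K[C̃]`. -/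
def idealAt (J : Ideal (Poly n K)) : Ideal (MvPolynomial (ParamCt J) K) :=
  (idealA J).comap (inclRing J)

/-- The specialization at `c : C̃ → K` of a polynomial of `K[C̃][x]`. -/
def specialize {J : Ideal (Poly n K)} (c : ParamCt J → K)
    (f : Poly n (MvPolynomial (ParamCt J) K)) : Poly n K :=
  MvPolynomial.map (MvPolynomial.eval c) f

end Generic

section Algorithm

variable {n : ℕ} {K : Type*} [Field K]

/-- The coefficient ring `K[C̃]`. -/
abbrev Coef (J : Ideal (Poly n K)) := MvPolynomial (ParamCt J) K

/-- The program points of the algorithm `markedScheme`; `todo` is the set of the elements that the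
current loop has still to process. -/
inductive Control (J : Ideal (Poly n K))
  /-- head of the loop over `sB_J` that builds `s𝒢` -/
  | build (todo : Set (Exp n))
  /-- head of the loop over `B_J \ sB_J` -/
  | loopGens (todo : Set (Exp n))
  /-- inside the call `superminimalReduction(x^α, s𝒢)` -/
  | callGen (todo : Set (Exp n)) (α : Exp n) (t : ℕ) (P : Poly n (Coef J))
  /-- head of the loop over `L_1` -/
  | loopPairs (todo : Set (Marked n (Coef J) × Marked n (Coef J)))
  /-- inside the call `superminimalReduction(S(F, F'), s𝒢)` -/
  | callPair (todo : Set (Marked n (Coef J) × Marked n (Coef J)))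
      (p : Marked n (Coef J) × Marked n (Coef J)) (t : ℕ) (P : Poly n (Coef J))
  /-- the algorithm has returned -/
  | returned

/-- The states of the algorithm `markedScheme`: the variables `𝒢̃`, `s𝒢`, `equations` and the
program point. -/
structure State (J : Ideal (Poly n K)) where
  Gt : Set (Marked n (Coef J))
  sG : Set (Marked n (Coef J))
  eqs : Set (Coef J)
  ctrl : Control J

/-- The initial state. -/
def initState (J : Ideal (Poly n K)) : State J :=
  ⟨∅, ∅, ∅, .build (superminimals J)⟩

/-- The steps of the algorithm `markedScheme`. The loops process their elements in arbitrary
order. For `H = H' + x_0^t H''`, with no monomial of `H'` divisible by `x_0^t`, the remainder `H'`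
is `H.modMonomial (Finsupp.single 0 t)` and the quotient `H''` is
`H.divMonomial (Finsupp.single 0 t)`. -/
inductive Step (J : Ideal (Poly n K)) : State J → State J → Prop
  | build (Gt sG eqs todo) (α : Exp n) (hα : α ∈ superminimals J) (h : α ∈ todo) :
      Step J ⟨Gt, sG, eqs, .build todo⟩
        ⟨insert (generic J (superminimals J) α hα) Gt,
          insert (generic J (superminimals J) α hα) sG, eqs, .build (todo \ {α})⟩
  | buildDone (Gt sG eqs) :
      Step J ⟨Gt, sG, eqs, .build ∅⟩
        ⟨Gt, sG, eqs, .loopGens (monomialBasis J \ superminimals J)⟩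
  | genCall (Gt sG eqs todo) (α : Exp n) (h : α ∈ todo) :
      Step J ⟨Gt, sG, eqs, .loopGens todo⟩
        ⟨Gt, sG, eqs, .callGen (todo \ {α}) α 0 (monomial α 1)⟩
  | genWork (Gt sG eqs todo) (α : Exp n) (t t' : ℕ) (P P' : Poly n (Coef J))
      (h : SMRStep J sG (monomial α 1) (t, P) (t', P')) :
      Step J ⟨Gt, sG, eqs, .callGen todo α t P⟩ ⟨Gt, sG, eqs, .callGen todo α t' P'⟩
  | genReturn (Gt sG eqs todo) (α : Exp n) (t : ℕ) (H : Poly n (Coef J))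
      (h : StronglyReduced J sG H) :
      Step J ⟨Gt, sG, eqs, .callGen todo α t H⟩
        ⟨insert ⟨α, monomial α 1 - H.divMonomial (Finsupp.single 0 t)⟩ Gt, sG,
          eqs ∪ (H.modMonomial (Finsupp.single 0 t)).coeffs, .loopGens todo⟩
  | gensDone (Gt sG eqs) :
      Step J ⟨Gt, sG, eqs, .loopGens ∅⟩ ⟨Gt, sG, eqs, .loopPairs (pairsL1 J sG)⟩
  | pairCall (Gt sG eqs todo) (p : Marked n (Coef J) × Marked n (Coef J)) (h : p ∈ todo) :
      Step J ⟨Gt, sG, eqs, .loopPairs todo⟩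
        ⟨Gt, sG, eqs, .callPair (todo \ {p}) p 0 (sPoly p.1 p.2)⟩
  | pairWork (Gt sG eqs todo) (p : Marked n (Coef J) × Marked n (Coef J)) (t t' : ℕ)
      (P P' : Poly n (Coef J)) (h : SMRStep J sG (sPoly p.1 p.2) (t, P) (t', P')) :
      Step J ⟨Gt, sG, eqs, .callPair todo p t P⟩ ⟨Gt, sG, eqs, .callPair todo p t' P'⟩
  | pairReturn (Gt sG eqs todo) (p : Marked n (Coef J) × Marked n (Coef J)) (t : ℕ)
      (H : Poly n (Coef J)) (h : StronglyReduced J sG H) :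
      Step J ⟨Gt, sG, eqs, .callPair todo p t H⟩
        ⟨Gt, sG, eqs ∪ H.coeffs, .loopPairs todo⟩
  | pairsDone (Gt sG eqs) :
      Step J ⟨Gt, sG, eqs, .loopPairs ∅⟩ ⟨Gt, sG, eqs, .returned⟩

/-- The states that occur in the runs of the algorithm. -/
def Reachable (J : Ideal (Poly n K)) (s : State J) : Prop :=
  Relation.ReflTransGen (Step J) (initState J) s

end Algorithm

end MarkedScheme

end

open MarkedScheme

/-!
Let `u` delete the exponents of some of the variables, and let `I` be an ideal whose monomials have
star decompositions. The star multiples of a marked family, whose heads decompose the monomials of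
`I` after applying `u`, form a unitriangular system for the order in which `x^γ` is ranked by the
cofactor of its decomposition. Elimination by such a system terminates, in the Dershowitz–Manna
order, and has a unique result. The reduction that defines `𝔄_J` is the case `u = id`, `I = J`, and
superminimal reduction is the case where `u` deletes `x_0` and `I = underIdeal J`; as `J` is a
truncation, a homogeneous polynomial of degree at least `m` that is reduced for one is reduced for
the other.

If the S-polynomials of the critical pairs `x_j x^{u α} = x^{u α'} *_I x^η` reduce to zero, then
the star multiples span, up to the deleted variables, the whole ideal. Hence a homomorphism
`φ : K[C̃] → A` that kills the equations of the algorithm extends to a unique marked basis over `A`,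
and so it factors through `K[C̃]/𝔄̃_J`. Applied to the quotient by the returned equations, this puts
`𝔄̃_J` into the ideal that they generate; applied to the generic marked basis over `K[C]/𝔄_J`, the
uniqueness gives the other inclusion and the surjectivity.
-/

noncomputable section

namespace MarkedScheme

/-! ### Star decompositions -/

section StarDecomposition

variable {n : ℕ} {K : Type*} [Field K] {I : Ideal (Poly n K)}

theorem monomial_mem_of_le {α β : Exp n} (hα : monomial α (1 : K) ∈ I) (hle : α ≤ β) :
    monomial β (1 : K) ∈ I := by
  have hβ : monomial β (1 : K) = monomial (β - α) 1 * monomial α 1 := by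
    rw [monomial_mul, tsub_add_cancel_of_le hle, one_mul]
  exact hβ ▸ I.mul_mem_left _ hα

theorem exists_monomialBasis_le {γ : Exp n} (hγ : monomial γ (1 : K) ∈ I) :
    ∃ α ∈ monomialBasis I, α ≤ γ := by
  obtain ⟨α, hαγ, hα⟩ := exists_minimal_le_of_wellFoundedLT
    (fun β : Exp n => monomial β (1 : K) ∈ I) γ hγ
  exact ⟨α, ⟨hα.prop, fun β hβ hle => hα.eq_of_le hβ hle⟩, hαγ⟩

theorem monomialBasis_finite (I : Ideal (Poly n K)) : (monomialBasis I).Finite := by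
  refine WellQuasiOrderedLE.finite_of_isAntichain fun α hα β hβ hne hle => ?_
  exact hne (hβ.2 α hα.1 hle)

/-- At the largest variable `x_i` where `ε` and `η` differ, `η` has the larger exponent; so `x_i`
divides `x^η` and `x^α` has no variable below `x_i`. -/
theorem le_of_toColex_le {α η ε δ : Exp n} (heq : α + η = ε + δ)
    (hstar : ∀ i ∈ α.support, ∀ j ∈ η.support, j ≤ i) (hle : toColex ε ≤ toColex η) :
    α ≤ δ := by
  have hcoord (i) : α i + η i = ε i + δ i := by simpa using DFunLike.congr_fun heq i
  rcases hle.eq_or_lt with h | h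
  · obtain rfl : ε = η := by simpa using h
    exact fun j => by have := hcoord j; lia
  obtain ⟨i, habove, hlt⟩ := Finsupp.Colex.lt_iff.1 h
  simp only [ofColex_toColex] at habove hlt
  intro j
  have hj := hcoord j
  rcases lt_trichotomy j i with hji | rfl | hij
  · have hα : α j = 0 := by
      by_contra hne
      have hi : i ∈ η.support := Finsupp.mem_support_iff.2 (by lia)
      exact (hstar j (Finsupp.mem_support_iff.2 hne) i hi).not_gt hji
    lia
  · lia
  · have := habove j hij
    lia

namespace IsStar

variable {γ α η : Exp n}

theorem mem (h : IsStar I γ α η) : monomial γ (1 : K) ∈ I :=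
  monomial_mem_of_le h.2.1.1 (h.1 ▸ le_self_add)

theorem cofactor_lt {δ ε : Exp n} (hδ : monomial δ (1 : K) ∉ I) (h : IsStar I (ε + δ) α η) :
    toColex η < toColex ε := by
  by_contra! hle
  exact hδ (monomial_mem_of_le h.2.1.1 (le_of_toColex_le h.1.symm h.2.2 hle))

theorem unique {α' η' : Exp n} (h : IsStar I γ α η) (h' : IsStar I γ α' η') :
    α = α' ∧ η = η' := by
  have hα : α = α' := by
    rcases le_total (toColex η') (toColex η) with hle | hle
    · exact h'.2.1.2 _ h.2.1.1
        (le_of_toColex_le (by rw [← h.1, h'.1, add_comm]) h.2.2 hle)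
    · exact (h.2.1.2 _ h'.2.1.1
        (le_of_toColex_le (by rw [← h'.1, h.1, add_comm]) h'.2.2 hle)).symm
  subst hα
  exact ⟨rfl, add_left_cancel (h.1.symm.trans h'.1)⟩

theorem cofactor_lt_single {α' : Exp n} {i j : Fin (n + 1)} (hα : α ∈ monomialBasis I)
    (hi : i ∈ α.support) (hij : i < j) (h : IsStar I (Finsupp.single j 1 + α) α' η) :
    toColex η < toColex (Finsupp.single j 1) := by
  by_contra! hle
  obtain rfl := hα.2 _ h.2.1.1 (le_of_toColex_le h.1.symm h.2.2 hle)
  have hη : η = Finsupp.single j 1 := add_left_cancel (h.1.symm.trans (add_comm _ _))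
  exact (h.2.2 i hi j (by simp [hη])).not_gt hij

theorem add_single {k : Fin (n + 1)} (h : IsStar I γ α η) (hk : ∀ i ∈ γ.support, k ≤ i) :
    IsStar I (γ + Finsupp.single k 1) α (η + Finsupp.single k 1) := by
  classical
  refine ⟨by rw [h.1, add_assoc], h.2.1, fun i hi j hj => ?_⟩
  rcases Finset.mem_union.1 (Finsupp.support_add hj) with hj | hj
  · exact h.2.2 i hi j hj
  · obtain rfl : j = k := Finset.mem_singleton.1 (Finsupp.support_single_subset hj)
    have hle : α ≤ γ := h.1 ▸ le_self_add
    exact hk i (Finsupp.support_mono hle hi)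

end IsStar

/-- Every monomial of `I` has a star decomposition (`I` is quasi-stable); this is all that
termination of the reductions needs from strong stability. -/
def HasStarDecompositions (I : Ideal (Poly n K)) : Prop :=
  ∀ γ : Exp n, monomial γ (1 : K) ∈ I → ∃ α η, IsStar I γ α η

theorem IsStronglyStable.monomial_sub_single_mem (hI : IsStronglyStable I) {γ : Exp n}
    {k : Fin (n + 1)} (hγ : monomial γ (1 : K) ∈ I) (hbasis : γ ∉ monomialBasis I)
    (hkγ : k ∈ γ.support) (hk : ∀ i ∈ γ.support, k ≤ i) :
    monomial (γ - Finsupp.single k 1) (1 : K) ∈ I := by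
  have hcancel (l) (hl : l ∈ γ.support) : γ - Finsupp.single l 1 + Finsupp.single l 1 = γ :=
    tsub_add_cancel_of_le (Finsupp.single_le_iff.2
      (Nat.one_le_iff_ne_zero.2 (Finsupp.mem_support_iff.1 hl)))
  obtain ⟨α, hα, hle⟩ := exists_monomialBasis_le hγ
  obtain ⟨i, hi⟩ : ∃ i, α i < γ i := by
    by_contra! hge
    exact hbasis (le_antisymm hle hge ▸ hα)
  have hiγ : i ∈ γ.support := Finsupp.mem_support_iff.2 (by lia)
  have hmem : monomial (γ - Finsupp.single i 1) (1 : K) ∈ I := by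
    refine monomial_mem_of_le hα.1 fun l => ?_
    have := hle l
    rw [Finsupp.tsub_apply, Finsupp.single_apply]
    split_ifs with hl
    · subst hl; lia
    · lia
  rcases (hk i hiγ).eq_or_lt with rfl | hki
  · exact hmem
  · refine hI _ _ hmem (Relation.TransGen.single ⟨k, i, hki, ?_⟩)
    rw [hcancel i hiγ, hcancel k hkγ]

theorem IsStronglyStable.hasStarDecompositions (hI : IsStronglyStable I) :
    HasStarDecompositions I := by
  intro γ
  induction γ using WellFoundedLT.induction with
  | ind γ ih =>
    intro hγ
    by_cases hbasis : γ ∈ monomialBasis I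
    · exact ⟨γ, 0, (add_zero γ).symm, hbasis, by simp⟩
    have hne : γ.support.Nonempty := by
      rw [Finsupp.support_nonempty_iff]
      rintro rfl
      exact hbasis ⟨hγ, fun β _ hβ => le_antisymm hβ (zero_le)⟩
    obtain ⟨k, hkγ, hk : ∀ i ∈ γ.support, k ≤ i⟩ := γ.support.exists_min_image id hne
    have hle : Finsupp.single k 1 ≤ γ := Finsupp.single_le_iff.2
      (Nat.one_le_iff_ne_zero.2 (Finsupp.mem_support_iff.1 hkγ))
    have hlt : γ - Finsupp.single k 1 < γ :=
      lt_of_le_of_ne tsub_le_self fun h => by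
        have := tsub_add_cancel_of_le hle
        rw [h] at this
        simp at this
    obtain ⟨α, η, hstar⟩ := ih _ hlt (hI.monomial_sub_single_mem hγ hbasis hkγ hk)
    have hstar' := hstar.add_single fun i hi => hk i (Finsupp.support_mono tsub_le_self hi)
    rw [tsub_add_cancel_of_le hle] at hstar'
    exact ⟨α, _, hstar'⟩

open Classical in
/-- The rank of `x^γ` is the cofactor `η` of its star decomposition `x^γ = x^α *_I x^η`, ordered
colexicographically, and `⊥` if there is none. Reductions replace a monomial by monomials of
smaller rank. -/
def rank (I : Ideal (Poly n K)) (γ : Exp n) : WithBot (Colex (Exp n)) :=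
  if h : ∃ η α, IsStar I γ α η then ↑(toColex h.choose) else ⊥

theorem IsStar.rank_eq {γ α η : Exp n} (h : IsStar I γ α η) : rank I γ = ↑(toColex η) := by
  have hex : ∃ η α, IsStar I γ α η := ⟨η, α, h⟩
  obtain ⟨α', h'⟩ := hex.choose_spec
  rw [rank, dif_pos hex, (h.unique h').2]

theorem rank_add_lt {ε δ : Exp n} (hδ : monomial δ (1 : K) ∉ I) :
    rank I (ε + δ) < ↑(toColex ε) := by
  by_cases hex : ∃ η α, IsStar I (ε + δ) α η
  · obtain ⟨η, α, h⟩ := hex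
    rw [h.rank_eq, WithBot.coe_lt_coe]
    exact h.cofactor_lt hδ
  · rw [rank, dif_neg hex]
    exact WithBot.bot_lt_coe _

end StarDecomposition

section Truncation

variable {n : ℕ} {K : Type*} [Field K] {J : Ideal (Poly n K)}

theorem under_apply (α : Exp n) (i : Fin (n + 1)) : under α i = if i = 0 then 0 else α i := by
  rw [under, Finsupp.erase_apply]

theorem under_le (α : Exp n) : under α ≤ α := fun i => by
  rw [under_apply]; split_ifs <;> simp

theorem under_add (α β : Exp n) : under (α + β) = under α + under β := Finsupp.erase_add _ _ _

theorem under_single_zero (t : ℕ) : under (Finsupp.single 0 t : Exp n) = 0 :=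
  Finsupp.erase_single

theorem under_add_single_zero (α : Exp n) : under α + Finsupp.single 0 (α 0) = α :=
  Finsupp.erase_add_single 0 α

theorem under_le_of_le_add_single_zero {α γ : Exp n} {t : ℕ}
    (h : α ≤ γ + Finsupp.single 0 t) : under α ≤ γ := fun i => by
  have hi := h i
  rw [under_apply]
  split_ifs with h0
  · exact Nat.zero_le _
  · simpa [Finsupp.single_apply, Ne.symm h0] using hi

theorem forall_mem_support_monomial {σ R : Type*} [CommSemiring R] [Nontrivial R]
    {P : (σ →₀ ℕ) → Prop} {γ : σ →₀ ℕ} :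
    (∀ δ ∈ (monomial γ (1 : R)).support, P δ) ↔ P γ := by
  classical
  simp [support_monomial]

theorem monomial_mem_underIdeal_iff {γ : Exp n} :
    monomial γ (1 : K) ∈ underIdeal J ↔
      ∃ t : ℕ, monomial (γ + Finsupp.single 0 t) (1 : K) ∈ J := by
  rw [underIdeal, ← Set.image_image (fun β => monomial β (1 : K)) under,
    mem_ideal_span_monomial_image, forall_mem_support_monomial, Set.exists_mem_image]
  constructor
  · rintro ⟨α, hα, hle⟩
    refine ⟨α 0, monomial_mem_of_le hα.1 ?_⟩
    calc α = under α + Finsupp.single 0 (α 0) := (under_add_single_zero α).symm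
      _ ≤ γ + Finsupp.single 0 (α 0) := by gcongr
  · rintro ⟨t, ht⟩
    obtain ⟨α, hα, hle⟩ := exists_monomialBasis_le ht
    exact ⟨α, hα, under_le_of_le_add_single_zero hle⟩

theorem monomial_mem_underIdeal {γ : Exp n} (h : monomial γ (1 : K) ∈ J) :
    monomial γ (1 : K) ∈ underIdeal J :=
  monomial_mem_underIdeal_iff.2 ⟨0, by simpa using h⟩

theorem monomial_under_mem_underIdeal_iff {γ : Exp n} :
    monomial (under γ) (1 : K) ∈ underIdeal J ↔ monomial γ (1 : K) ∈ underIdeal J := by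
  refine ⟨fun h => monomial_mem_of_le h (under_le γ), fun h => ?_⟩
  obtain ⟨t, ht⟩ := monomial_mem_underIdeal_iff.1 h
  refine monomial_mem_underIdeal_iff.2 ⟨γ 0 + t, ?_⟩
  rwa [Finsupp.single_add, ← add_assoc, under_add_single_zero]

theorem IncreasingMove.add_right {α β : Exp n} (h : IncreasingMove α β) (τ : Exp n) :
    IncreasingMove (α + τ) (β + τ) := by
  obtain ⟨i, j, hij, heq⟩ := h
  exact ⟨i, j, hij, by rw [add_right_comm, heq, add_right_comm]⟩

theorem IsStronglyStable.underIdeal (hJ : IsStronglyStable J) :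
    IsStronglyStable (underIdeal J) := by
  intro α β hα hαβ
  obtain ⟨t, ht⟩ := monomial_mem_underIdeal_iff.1 hα
  exact monomial_mem_underIdeal_iff.2 ⟨t, hJ _ _ ht (Relation.TransGen.lift
    (fun γ => γ + Finsupp.single 0 t) (fun _ _ h => h.add_right _) _ _ hαβ)⟩

theorem IsStronglyStable.monomial_add_single_mem (hJ : IsStronglyStable J) (j : Fin (n + 1))
    (t : ℕ) (γ : Exp n) (h : monomial (γ + Finsupp.single 0 t) (1 : K) ∈ J) :
    monomial (γ + Finsupp.single j t) (1 : K) ∈ J := by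
  rcases eq_or_ne j 0 with rfl | hj
  · exact h
  induction t generalizing γ with
  | zero => simpa using h
  | succ t ih =>
    have hmove : monomial (γ + Finsupp.single j 1 + Finsupp.single 0 t) (1 : K) ∈ J := by
      refine hJ _ _ h (Relation.TransGen.single ⟨0, j, Fin.pos_iff_ne_zero.2 hj, ?_⟩)
      rw [Finsupp.single_add]
      abel
    rw [add_comm t, Finsupp.single_add, ← add_assoc]
    exact ih _ hmove

/-- The monomials of `J` are those of `underIdeal J` of degree at least `m`. For a strongly stable
ideal this is `IsTruncation m J`, in the form in which the reductions use it. -/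
def IsUnderTruncation (m : ℕ) (J : Ideal (Poly n K)) : Prop :=
  ∀ γ : Exp n, monomial γ (1 : K) ∈ J ↔ monomial γ (1 : K) ∈ underIdeal J ∧ m ≤ γ.degree

theorem IsTruncation.isUnderTruncation {m : ℕ} (hss : IsStronglyStable J)
    (htr : IsTruncation m J) : IsUnderTruncation m J := by
  intro γ
  have hX (j : Fin (n + 1)) (r : ℕ) :
      X j ^ r * monomial γ (1 : K) = monomial (γ + Finsupp.single j r) 1 := by
    rw [X_pow_eq_monomial, monomial_mul, one_mul, add_comm γ]
  rw [htr (monomial γ 1), forall_mem_support_monomial]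
  simp only [saturation, Set.mem_ofPred_eq, hX, monomial_mem_underIdeal_iff]
  refine and_congr_left fun _ => ⟨fun h => h 0, fun ⟨t, ht⟩ j => ⟨t, ?_⟩⟩
  exact hss.monomial_add_single_mem j t γ ht

theorem exists_superminimal {β : Exp n} (hβ : β ∈ monomialBasis (underIdeal J)) :
    ∃ α ∈ superminimals J, under α = β := by
  obtain ⟨t, ht⟩ := monomial_mem_underIdeal_iff.1 hβ.1
  obtain ⟨α, hα, hle⟩ := exists_monomialBasis_le ht
  have hαβ : under α = β :=
    hβ.2 _ (monomial_under_mem_underIdeal_iff.2 (monomial_mem_underIdeal hα.1))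
      (under_le_of_le_add_single_zero hle)
  exact ⟨α, ⟨hα, hαβ ▸ hβ⟩, hαβ⟩

theorem injOn_under_monomialBasis (J : Ideal (Poly n K)) :
    Set.InjOn under (monomialBasis J) := by
  intro α hα β hβ h
  wlog h0 : α 0 ≤ β 0 generalizing α β
  · exact (this hβ hα h.symm (le_of_not_ge h0)).symm
  refine hβ.2 _ hα.1 ?_
  rw [← under_add_single_zero α, ← under_add_single_zero β, h]
  gcongr

theorem superminimals_subset (J : Ideal (Poly n K)) : superminimals J ⊆ monomialBasis J :=
  fun _ h => h.1

theorem mem_sousEscalierDeg {d : ℕ} {γ : Exp n} :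
    γ ∈ sousEscalierDeg J d ↔ γ.degree = d ∧ γ ∈ sousEscalier J := by
  simp [sousEscalierDeg, Finset.mem_finsuppAntidiag, Finsupp.degree_eq_sum]

end Truncation

/-! ### Reduction by unitriangular sets of marked polynomials -/

section Reduction

open Relation

variable {n : ℕ} {A : Type*} [CommRing A] {W : Type*} [Preorder W]
  {r : Exp n → W} {P : Set (Marked n A)}

/-- The head terms of the polynomials of `P` are distinct, have coefficient `1`, and have greater
rank `r` than the other monomials of the same polynomial. -/
structure IsUnitriangular (r : Exp n → W) (P : Set (Marked n A)) : Prop where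
  injOn : Set.InjOn Marked.head P
  coeff_head : ∀ q ∈ P, q.poly.coeff q.head = 1
  rank_lt : ∀ q ∈ P, ∀ δ, δ ≠ q.head → q.poly.coeff δ ≠ 0 → r δ < r q.head

/-- Elimination of the monomial `q.head` by subtracting a scalar multiple of some `q ∈ P`. Both the
steps `VStep` and the steps `SGStep` are of this form, `P` consisting of the admissible multiples
of the marked polynomials. -/
def ReductionStep (P : Set (Marked n A)) (h h₁ : Poly n A) : Prop :=
  ∃ q ∈ P, q.head ∈ h.support ∧ h₁ = h - C (h.coeff q.head) * q.poly

/-- Zero or more reduction steps. -/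
abbrev Reduces (P : Set (Marked n A)) : Poly n A → Poly n A → Prop :=
  ReflTransGen (ReductionStep P)

theorem coeff_head_eq_zero_of_irreducible {h : Poly n A} (hirr : ∀ h₁, ¬ ReductionStep P h h₁)
    {q : Marked n A} (hq : q ∈ P) : h.coeff q.head = 0 := by
  by_contra hne
  exact hirr _ ⟨q, hq, mem_support_iff.2 hne, rfl⟩

theorem Reduces.sub_mem_span {h R : Poly n A} (hR : Reduces P h R) :
    h - R ∈ Submodule.span A (Marked.poly '' P) := by
  induction hR with
  | refl => simp
  | tail _ hs ih =>
    obtain ⟨q, hq, -, rfl⟩ := hs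
    rw [← sub_add, C_mul']
    exact add_mem ih (Submodule.smul_mem _ _ (Submodule.subset_span ⟨q, hq, rfl⟩))

theorem isDershowitzMannaLT_map {ι : Type*} [DecidableEq ι] {r : ι → W} {s t : Finset ι} {a : ι}
    (ha : a ∈ s \ t) (hlt : ∀ b ∈ t \ s, r b < r a) :
    Multiset.IsDershowitzMannaLT (t.val.map r) (s.val.map r) := by
  have hsplit (u v : Finset ι) :
      u.val.map r = (u ∩ v).val.map r + (u \ v).val.map r := by
    rw [← Multiset.map_add, Finset.inter_val, Finset.sdiff_val, add_comm,
      Multiset.sub_add_inter]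
  refine ⟨(s ∩ t).val.map r, (t \ s).val.map r, (s \ t).val.map r, ?_,
    Finset.inter_comm s t ▸ hsplit t s, hsplit s t, fun y hy => ?_⟩
  · rw [Multiset.empty_eq_zero, ne_eq, Multiset.map_eq_zero, Finset.val_eq_zero]
    exact Finset.ne_empty_of_mem ha
  · obtain ⟨b, hb, rfl⟩ := Multiset.mem_map.1 hy
    exact ⟨r a, Multiset.mem_map_of_mem r ha, hlt b hb⟩

/-- The multiset of the ranks of the monomials of `h`; it decreases in the Dershowitz–Manna order
with each reduction step. -/
def rankMultiset (r : Exp n → W) (h : Poly n A) : Multiset W := h.support.val.map r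

namespace IsUnitriangular

theorem eq_zero_of_mem_span (hP : IsUnitriangular r P) {h : Poly n A}
    (hh : h ∈ Submodule.span A (Marked.poly '' P)) (hs : ∀ q ∈ P, h.coeff q.head = 0) :
    h = 0 := by
  obtain ⟨l, hl, rfl⟩ := (Finsupp.mem_span_image_iff_linearCombination A).1 hh
  rw [Finsupp.mem_supported] at hl
  by_contra hne
  have hl0 : l ≠ 0 := by
    rintro rfl
    exact hne (map_zero _)
  -- At a head of maximal rank among those that occur, there is no cancellation.
  obtain ⟨q, hq, hmax⟩ := l.support.exists_maximalFor (fun q => r q.head)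
    (Finsupp.support_nonempty_iff.2 hl0)
  refine Finsupp.mem_support_iff.1 hq ?_
  have hcoeff := hs q (hl hq)
  rwa [Finsupp.linearCombination_apply, Finsupp.sum, coeff_sum,
    Finset.sum_eq_single_of_mem q hq, coeff_smul, hP.coeff_head q (hl hq), smul_eq_mul,
    mul_one] at hcoeff
  intro q' hq' hne
  rw [coeff_smul, smul_eq_mul]
  by_contra hcon
  have hlt : r q.head < r q'.head := hP.rank_lt q' (hl hq') _
    (fun heq => hne (hP.injOn (hl hq') (hl hq) heq.symm)) (right_ne_zero_of_mul hcon)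
  exact (hmax hq' hlt.le).not_gt hlt

theorem reduces_unique (hP : IsUnitriangular r P) {h R R' : Poly n A} (hR : Reduces P h R)
    (hR' : Reduces P h R') (h0 : ∀ q ∈ P, R.coeff q.head = 0)
    (h0' : ∀ q ∈ P, R'.coeff q.head = 0) : R = R' := by
  refine sub_eq_zero.1 (hP.eq_zero_of_mem_span ?_ fun q hq => ?_)
  · simpa using sub_mem hR'.sub_mem_span hR.sub_mem_span
  · rw [coeff_sub, h0 q hq, h0' q hq, sub_zero]

theorem exists_support_of_reductionStep (hP : IsUnitriangular r P) {h h₁ : Poly n A}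
    (hs : ReductionStep P h h₁) :
    ∃ q ∈ P, q.head ∈ h.support ∧ q.head ∉ h₁.support ∧
      ∀ δ ∈ h₁.support, δ ∉ h.support → r δ < r q.head := by
  obtain ⟨q, hq, hh, rfl⟩ := hs
  refine ⟨q, hq, hh, by simp [coeff_C_mul, hP.coeff_head q hq], fun δ hδ hδh => ?_⟩
  rw [mem_support_iff, coeff_sub, notMem_support_iff.1 hδh, coeff_C_mul, zero_sub,
    neg_ne_zero] at hδ
  exact hP.rank_lt q hq δ (fun heq => hδh (heq ▸ hh)) (right_ne_zero_of_mul hδ)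

theorem rankMultiset_lt (hP : IsUnitriangular r P) {h h₁ : Poly n A}
    (hs : ReductionStep P h h₁) :
    Multiset.IsDershowitzMannaLT (rankMultiset r h₁) (rankMultiset r h) := by
  classical
  obtain ⟨q, -, hh, hh₁, hlt⟩ := hP.exists_support_of_reductionStep hs
  exact isDershowitzMannaLT_map (Finset.mem_sdiff.2 ⟨hh, hh₁⟩)
    fun δ hδ => hlt δ (Finset.mem_sdiff.1 hδ).1 (Finset.mem_sdiff.1 hδ).2

theorem wellFounded [WellFoundedLT W] (hP : IsUnitriangular r P) :
    WellFounded (fun h₁ h : Poly n A => ReductionStep P h h₁) :=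
  Subrelation.wf (fun hs => hP.rankMultiset_lt hs)
    (InvImage.wf (rankMultiset r) Multiset.wellFounded_isDershowitzMannaLT)

theorem rank_lt_of_reduces (hP : IsUnitriangular r P) {w : W} {h R : Poly n A}
    (hR : Reduces P h R) (hw : ∀ γ ∈ h.support, r γ < w) : ∀ γ ∈ R.support, r γ < w := by
  induction hR with
  | refl => exact hw
  | @tail b _ _ hs ih =>
    obtain ⟨q, -, hh, -, hlt⟩ := hP.exists_support_of_reductionStep hs
    intro γ hγ
    by_cases hγb : γ ∈ b.support
    · exact ih γ hγb
    · exact (hlt γ hγ hγb).trans (ih _ hh)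

theorem sub_mem_span_rank_lt (hP : IsUnitriangular r P) {w : W} {h R : Poly n A}
    (hR : Reduces P h R) (hw : ∀ γ ∈ h.support, r γ < w) :
    h - R ∈ Submodule.span A (Marked.poly '' {q ∈ P | r q.head < w}) := by
  induction hR with
  | refl => simp
  | tail hR hs ih =>
    obtain ⟨q, hq, hh, rfl⟩ := hs
    have hqw : r q.head < w := hP.rank_lt_of_reduces hR hw _ hh
    rw [← sub_add, C_mul']
    exact add_mem ih (Submodule.smul_mem _ _ (Submodule.subset_span ⟨q, ⟨hq, hqw⟩, rfl⟩))

end IsUnitriangular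

end Reduction

/-! ### Reduction by star multiples of a marked family -/

section ReductionSystem

variable {n : ℕ} {K : Type*} [Field K] {A : Type*} [CommRing A]

theorem exists_of_coeff_monomial_mul_ne_zero {σ R : Type*} [CommSemiring R] {ε δ : σ →₀ ℕ} {a : R}
    {h : MvPolynomial σ R} (hne : (monomial ε a * h).coeff δ ≠ 0) :
    ∃ δ', δ = ε + δ' ∧ h.coeff δ' ≠ 0 := by
  rw [coeff_monomial_mul'] at hne
  split_ifs at hne with hle
  · exact ⟨δ - ε, (add_tsub_cancel_of_le hle).symm, right_ne_zero_of_mul hne⟩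
  · exact absurd rfl hne

theorem monomial_one_mul_monomial_one_mul {σ R : Type*} [CommSemiring R] (ε δ : σ →₀ ℕ)
    (h : MvPolynomial σ R) :
    monomial ε 1 * (monomial δ 1 * h) = monomial (ε + δ) 1 * h := by
  rw [← mul_assoc, monomial_mul, one_mul]

theorem mul_mem_of_mem_span {R : Type*} [CommRing R] [Algebra A R] {s : Set R}
    {N : Submodule A R} {p h : R} (hh : h ∈ Submodule.span A s) (hs : ∀ g ∈ s, p * g ∈ N) :
    p * h ∈ N :=
  (Submodule.span_le.2 hs : Submodule.span A s ≤ N.comap (LinearMap.mulLeft A p)) hh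

theorem map_mem_of_mem_span {σ A' : Type*} [CommRing A'] (φ : A →+* A')
    {s : Set (MvPolynomial σ A)} {N : Submodule A' (MvPolynomial σ A')} {g : MvPolynomial σ A}
    (hg : g ∈ Submodule.span A s) (hs : ∀ p ∈ s, map φ p ∈ N) : map φ g ∈ N := by
  induction hg using Submodule.span_induction with
  | mem g hg => exact hs g hg
  | zero => rw [map_zero]; exact zero_mem N
  | add g g' _ _ h h' => rw [map_add]; exact add_mem h h'
  | smul a g _ h =>
    rw [← C_mul', map_mul, map_C, C_mul']
    exact N.smul_mem _ h

/-- `u` keeps the exponents of some of the variables and deletes those of the others. The cases in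
use are `id` (for the reductions `VStep`) and `under` (for the reductions `SGStep`). -/
def IsRestriction (u : Exp n → Exp n) : Prop :=
  ∀ i, (∀ α, u α i = α i) ∨ ∀ α, u α i = 0

namespace IsRestriction

variable {u : Exp n → Exp n}

theorem zero (hu : IsRestriction u) : u 0 = 0 := by
  ext i; rcases hu i with h | h <;> simp [h]

theorem add (hu : IsRestriction u) (α β : Exp n) : u (α + β) = u α + u β := by
  ext i; rcases hu i with h | h <;> simp [h]

theorem tsub (hu : IsRestriction u) (α β : Exp n) : u (α - β) = u α - u β := by
  ext i; rcases hu i with h | h <;> simp [h]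

theorem sup (hu : IsRestriction u) (α β : Exp n) : u (α ⊔ β) = u α ⊔ u β := by
  ext i; rcases hu i with h | h <;> simp [h]

theorem le (hu : IsRestriction u) (α : Exp n) : u α ≤ α := fun i => by
  rcases hu i with h | h <;> simp [h]

theorem idem (hu : IsRestriction u) (α : Exp n) : u (u α) = u α := by
  ext i; rcases hu i with h | h <;> simp [h]

theorem tsub_self_apply (hu : IsRestriction u) (α : Exp n) : u (α - u α) = 0 := by
  rw [hu.tsub, hu.idem, tsub_self]

theorem single (hu : IsRestriction u) {α : Exp n} {j : Fin (n + 1)} (hj : j ∈ (u α).support) :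
    u (Finsupp.single j 1) = Finsupp.single j 1 := by
  ext i
  rcases hu i with h | h
  · exact h _
  · have hij : i ≠ j := by
      rintro rfl
      exact Finsupp.mem_support_iff.1 hj (h α)
    rw [h, Finsupp.single_eq_of_ne hij]

end IsRestriction

/-- The multiples `x^ε f α`, `α ∈ B`, whose head term has the star decomposition
`x^{u α} *_I x^{u ε}` after restriction by `u`. -/
def starMultiples (u : Exp n → Exp n) (I : Ideal (Poly n K)) (B : Set (Exp n))
    (f : Exp n → Poly n A) : Set (Marked n A) :=
  {q | ∃ α ∈ B, ∃ ε, IsStar I (u α + u ε) (u α) (u ε) ∧ q = ⟨α + ε, monomial ε 1 * f α⟩}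

/-- The `A`-module spanned by the star multiples. -/
abbrev starSpan (u : Exp n → Exp n) (I : Ideal (Poly n K)) (B : Set (Exp n))
    (f : Exp n → Poly n A) : Submodule A (Poly n A) :=
  Submodule.span A (Marked.poly '' starMultiples u I B f)

/-- The data of a reduction procedure: marked polynomials `f α` with heads `α ∈ B`, such that `u`
maps `B` bijectively onto the minimal generators of `I` and restricts all other monomials of `f α`
to monomials outside `I`. -/
structure IsReductionSystem (u : Exp n → Exp n) (I : Ideal (Poly n K)) (B : Set (Exp n))
    (f : Exp n → Poly n A) : Prop where
  restr : IsRestriction u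
  bijOn : Set.BijOn u B (monomialBasis I)
  coeff_head : ∀ α ∈ B, (f α).coeff α = 1
  tail : ∀ α ∈ B, ∀ δ, δ ≠ α → (f α).coeff δ ≠ 0 → monomial (u δ) (1 : K) ∉ I

variable {u : Exp n → Exp n} {I : Ideal (Poly n K)} {B : Set (Exp n)} {f : Exp n → Poly n A}

section Restriction

variable {τ : Exp n}

theorem starMultiples_monomial_mul (hu : IsRestriction u) (hτ : u τ = 0) {q : Marked n A}
    (hq : q ∈ starMultiples u I B f) :
    (⟨τ + q.head, monomial τ 1 * q.poly⟩ : Marked n A) ∈ starMultiples u I B f := by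
  obtain ⟨α, hα, ε, hstar, rfl⟩ := hq
  refine ⟨α, hα, τ + ε, by rwa [hu.add, hτ, zero_add], ?_⟩
  rw [monomial_one_mul_monomial_one_mul, add_left_comm]

theorem Reduces.monomial_mul (hu : IsRestriction u) (hτ : u τ = 0) {h h₁ : Poly n A}
    (hr : Reduces (starMultiples u I B f) h h₁) :
    Reduces (starMultiples u I B f) (monomial τ 1 * h) (monomial τ 1 * h₁) := by
  refine Relation.ReflTransGen.lift (fun g => monomial τ 1 * g) ?_ _ _ hr
  rintro g _ ⟨q, hq, hg, rfl⟩
  refine ⟨_, starMultiples_monomial_mul hu hτ hq, ?_, ?_⟩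
  · rw [mem_support_iff] at hg ⊢
    rwa [coeff_monomial_mul, one_mul]
  · rw [coeff_monomial_mul, one_mul]
    ring

theorem monomial_mul_mem_starSpan (hu : IsRestriction u) (hτ : u τ = 0) {h : Poly n A}
    (hh : h ∈ starSpan u I B f) : monomial τ 1 * h ∈ starSpan u I B f := by
  refine mul_mem_of_mem_span hh ?_
  rintro _ ⟨q, hq, rfl⟩
  exact Submodule.subset_span ⟨_, starMultiples_monomial_mul hu hτ hq, rfl⟩

theorem support_monomial_mul (τ : Exp n) (h : Poly n A) :
    (monomial τ 1 * h).support = h.support.map (addLeftEmbedding τ) := by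
  ext δ
  rw [mem_support_iff, Finset.mem_map]
  constructor
  · intro hne
    obtain ⟨δ', rfl, hδ'⟩ := exists_of_coeff_monomial_mul_ne_zero hne
    exact ⟨δ', mem_support_iff.2 hδ', rfl⟩
  · rintro ⟨δ', hδ', rfl⟩
    rw [addLeftEmbedding_apply, coeff_monomial_mul, one_mul]
    exact mem_support_iff.1 hδ'

theorem rankMultiset_monomial_mul (hu : IsRestriction u) (hτ : u τ = 0) (h : Poly n A) :
    rankMultiset (rank I ∘ u) (monomial τ 1 * h) = rankMultiset (rank I ∘ u) h := by
  rw [rankMultiset, support_monomial_mul, Finset.map_val, Multiset.map_map, rankMultiset]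
  refine Multiset.map_congr rfl fun γ _ => ?_
  simp [hu.add, hτ]

variable (I B f) in
/-- The saturation of `starSpan` by the monomials that `u` deletes. -/
def saturatedSpan (hu : IsRestriction u) : Submodule A (Poly n A) where
  carrier := {g | ∃ τ, u τ = 0 ∧ monomial τ 1 * g ∈ starSpan u I B f}
  zero_mem' := ⟨0, hu.zero, by simp⟩
  add_mem' := by
    rintro g g' ⟨τ, hτ, hg⟩ ⟨τ', hτ', hg'⟩
    refine ⟨τ + τ', by rw [hu.add, hτ, hτ', add_zero], ?_⟩
    have hτg := monomial_mul_mem_starSpan hu hτ' hg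
    have hτg' := monomial_mul_mem_starSpan hu hτ hg'
    rw [monomial_one_mul_monomial_one_mul] at hτg hτg'
    rw [mul_add]
    exact add_mem (by rwa [add_comm τ τ']) hτg'
  smul_mem' := by
    rintro a g ⟨τ, hτ, hg⟩
    refine ⟨τ, hτ, ?_⟩
    rw [mul_smul_comm]
    exact Submodule.smul_mem _ _ hg

theorem mem_saturatedSpan_of_monomial_mul {hu : IsRestriction u} {g : Poly n A} (hτ : u τ = 0)
    (hg : monomial τ 1 * g ∈ saturatedSpan I B f hu) : g ∈ saturatedSpan I B f hu := by
  obtain ⟨τ', hτ', h⟩ := hg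
  refine ⟨τ' + τ, by rw [hu.add, hτ, hτ', add_zero], ?_⟩
  rwa [monomial_one_mul_monomial_one_mul] at h

theorem starSpan_le_saturatedSpan (hu : IsRestriction u) :
    starSpan u I B f ≤ saturatedSpan I B f hu :=
  fun g hg => ⟨0, hu.zero, by rwa [← C_apply, C_1, one_mul]⟩

end Restriction

namespace IsReductionSystem

theorem rank_lt_of_coeff_monomial_mul_ne_zero (hS : IsReductionSystem u I B f) {α ε γ : Exp n}
    (hα : α ∈ B) (hne : γ ≠ ε + α) (hγ : (monomial ε 1 * f α).coeff γ ≠ 0) :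
    rank I (u γ) < ↑(toColex (u ε)) := by
  obtain ⟨δ, rfl, hδ⟩ := exists_of_coeff_monomial_mul_ne_zero hγ
  rw [hS.restr.add]
  exact rank_add_lt (hS.tail α hα δ (fun h => hne (by rw [h])) hδ)

theorem isUnitriangular (hS : IsReductionSystem u I B f) :
    IsUnitriangular (rank I ∘ u) (starMultiples u I B f) where
  injOn := by
    rintro _ ⟨α, hα, ε, hstar, rfl⟩ _ ⟨α', hα', ε', hstar', rfl⟩ (heq : α + ε = α' + ε')
    have hu : u α + u ε = u α' + u ε' := by rw [← hS.restr.add, heq, hS.restr.add]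
    obtain rfl := hS.bijOn.injOn hα hα' (hstar.unique (hu ▸ hstar')).1
    obtain rfl := add_left_cancel heq
    rfl
  coeff_head := by
    rintro _ ⟨α, hα, ε, -, rfl⟩
    change coeff (α + ε) (monomial ε 1 * f α) = 1
    rw [add_comm α ε, coeff_monomial_mul, one_mul, hS.coeff_head α hα]
  rank_lt := by
    rintro _ ⟨α, hα, ε, hstar, rfl⟩ δ hne hδ
    change rank I (u δ) < rank I (u (α + ε))
    rw [hS.restr.add, hstar.rank_eq]
    exact hS.rank_lt_of_coeff_monomial_mul_ne_zero hα (by rwa [add_comm]) hδ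

theorem exists_starMultiple (hS : IsReductionSystem u I B f) (hI : HasStarDecompositions I)
    {γ : Exp n} (hγ : monomial (u γ) (1 : K) ∈ I) :
    ∃ τ, u τ = 0 ∧ ∃ q ∈ starMultiples u I B f, q.head = τ + γ := by
  obtain ⟨β, η, hstar⟩ := hI _ hγ
  obtain ⟨α, hα, rfl⟩ := hS.bijOn.surjOn hstar.2.1
  -- Multiplication by the part of `x^α` that `u` deletes makes `x^γ` a multiple of `x^α`.
  have hτ : u (α - u α) = 0 := hS.restr.tsub_self_apply α
  have hle : α ≤ (α - u α) + γ := by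
    calc α = (α - u α) + u α := (tsub_add_cancel_of_le (hS.restr.le α)).symm
      _ ≤ (α - u α) + u γ := by rw [hstar.1]; gcongr; exact le_self_add
      _ ≤ (α - u α) + γ := by gcongr; exact hS.restr.le γ
  obtain ⟨ε, hε⟩ := exists_add_of_le hle
  have hu : u α + u ε = u γ := by rw [← hS.restr.add, ← hε, hS.restr.add, hτ, zero_add]
  have hη : u ε = η := add_left_cancel (hu.trans hstar.1)
  exact ⟨α - u α, hτ, _, ⟨α, hα, ε, by rwa [hu, hη], rfl⟩, hε.symm⟩

theorem exists_reduces (hS : IsReductionSystem u I B f) (hI : HasStarDecompositions I)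
    (h : Poly n A) :
    ∃ τ, u τ = 0 ∧ ∃ R, Reduces (starMultiples u I B f) (monomial τ 1 * h) R ∧
      ∀ γ ∈ R.support, monomial (u γ) (1 : K) ∉ I := by
  have hwf := InvImage.wf (rankMultiset (A := A) (rank I ∘ u))
    Multiset.wellFounded_isDershowitzMannaLT
  induction h using hwf.induction with
  | _ h ih =>
    by_cases hred : ∀ γ ∈ h.support, monomial (u γ) (1 : K) ∉ I
    · exact ⟨0, hS.restr.zero, h, by rw [← C_apply, C_1, one_mul], hred⟩
    push Not at hred
    obtain ⟨γ, hγ, hγI⟩ := hred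
    obtain ⟨τ, hτ, q, hq, hqγ⟩ := hS.exists_starMultiple hI hγI
    have hstep : ReductionStep (starMultiples u I B f) (monomial τ 1 * h)
        (monomial τ 1 * h - C ((monomial τ 1 * h).coeff q.head) * q.poly) := by
      refine ⟨q, hq, ?_, rfl⟩
      rw [mem_support_iff, hqγ, coeff_monomial_mul, one_mul]
      exact mem_support_iff.1 hγ
    have hlt := hS.isUnitriangular.rankMultiset_lt hstep
    rw [rankMultiset_monomial_mul hS.restr hτ] at hlt
    obtain ⟨τ', hτ', R, hR, hRI⟩ := ih _ hlt
    refine ⟨τ' + τ, by rw [hS.restr.add, hτ, hτ', add_zero], R, ?_, hRI⟩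
    rw [← monomial_one_mul_monomial_one_mul]
    exact (Reduces.monomial_mul hS.restr hτ' (.single hstep)).trans hR

theorem eq_zero_of_mem_saturatedSpan (hS : IsReductionSystem u I B f) {h : Poly n A}
    (hh : h ∈ saturatedSpan I B f hS.restr)
    (hred : ∀ γ ∈ h.support, monomial (u γ) (1 : K) ∉ I) : h = 0 := by
  obtain ⟨τ, hτ, hspan⟩ := hh
  have hτh : monomial τ 1 * h = 0 := by
    refine hS.isUnitriangular.eq_zero_of_mem_span hspan ?_
    rintro _ ⟨α, -, ε, hstar, rfl⟩
    by_contra hne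
    obtain ⟨δ, hδ : α + ε = τ + δ, hδh⟩ := exists_of_coeff_monomial_mul_ne_zero hne
    refine hred δ (mem_support_iff.2 hδh) ?_
    have hmem := hstar.mem
    rwa [← hS.restr.add, hδ, hS.restr.add, hτ, zero_add] at hmem
  ext δ
  have hδ := congrArg (coeff (τ + δ)) hτh
  rwa [coeff_monomial_mul, one_mul, coeff_zero] at hδ

end IsReductionSystem

end ReductionSystem

/-! ### A Buchberger criterion for critical pairs -/

section Criterion

variable {n : ℕ} {K : Type*} [Field K] {A : Type*} [CommRing A]
  {u : Exp n → Exp n} {I : Ideal (Poly n K)} {B : Set (Exp n)} {f : Exp n → Poly n A}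

theorem IsStar.sup_eq {α α' η : Exp n} {i j : Fin (n + 1)}
    (h : IsStar I (Finsupp.single j 1 + α) α' η) (hα : α ∈ monomialBasis I) (hi : i ∈ α.support)
    (hij : i < j) :
    α ⊔ α' = Finsupp.single j 1 + α := by
  have hle : α' ≤ Finsupp.single j 1 + α := h.1 ▸ le_self_add
  have hnle : ¬ α' ≤ α := by
    intro hle
    obtain rfl := hα.2 _ h.2.1.1 hle
    have hη : η = Finsupp.single j 1 := add_left_cancel (h.1.symm.trans (add_comm _ _))
    exact (h.cofactor_lt_single hα hi hij).ne (by rw [hη])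
  obtain ⟨k, hk⟩ : ∃ k, α k < α' k := by
    by_contra! hge
    exact hnle hge
  have hkj : k = j := by
    by_contra hne
    have := hle k
    rw [Finsupp.add_apply, Finsupp.single_eq_of_ne hne] at this
    lia
  subst hkj
  refine le_antisymm (sup_le le_add_self hle) fun l => ?_
  rw [Finsupp.add_apply, Finsupp.sup_apply, Finsupp.single_apply]
  split_ifs with hl
  · subst hl; lia
  · lia

theorem coeff_sPoly_sup {α α' : Exp n} {p p' : Poly n A} (hp : p.coeff α = 1)
    (hp' : p'.coeff α' = 1) : (sPoly ⟨α, p⟩ ⟨α', p'⟩).coeff (α ⊔ α') = 0 := by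
  have hcoeff {β : Exp n} {g : Poly n A} (hg : g.coeff β = 1) (hle : β ≤ α ⊔ α') :
      (monomial (α ⊔ α' - β) 1 * g).coeff (α ⊔ α') = 1 := by
    conv_lhs => rw [← tsub_add_cancel_of_le hle]
    simp [hg]
  rw [sPoly, coeff_sub, hcoeff hp le_sup_left, hcoeff hp' le_sup_right, sub_self]

theorem sPoly_map {A' : Type*} [CommRing A'] (φ : A →+* A') (α α' : Exp n) (p p' : Poly n A) :
    sPoly ⟨α, map φ p⟩ ⟨α', map φ p'⟩ = map φ (sPoly ⟨α, p⟩ ⟨α', p'⟩) := by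
  simp [sPoly]

/-- The multiples of the `f β` by monomials whose restriction by `u` is smaller than `x_j`. -/
def smallMultiples (u : Exp n → Exp n) (B : Set (Exp n)) (f : Exp n → Poly n A)
    (j : Fin (n + 1)) : Set (Poly n A) :=
  {g | ∃ β ∈ B, ∃ ε, toColex (u ε) < toColex (Finsupp.single j 1) ∧ g = monomial ε 1 * f β}

/-- The pairs of heads whose S-polynomials have to be examined: `x_j x^{u α} = x^{u α'} *_I x^η`,
where the left hand side is not a star decomposition because `x_j > min(x^{u α})`. -/
structure IsCriticalPair (u : Exp n → Exp n) (I : Ideal (Poly n K)) (B : Set (Exp n))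
    (j : Fin (n + 1)) (α α' η : Exp n) : Prop where
  left : α ∈ B
  right : α' ∈ B
  single : u (Finsupp.single j 1) = Finsupp.single j 1
  exists_lt : ∃ i ∈ (u α).support, i < j
  star : IsStar I (Finsupp.single j 1 + u α) (u α') η

namespace IsReductionSystem

variable {j : Fin (n + 1)} {α α' η τ : Exp n}

theorem cofactor_lt_of_criticalPair (hS : IsReductionSystem u I B f)
    (hp : IsCriticalPair u I B j α α' η) : toColex η < toColex (Finsupp.single j 1) :=
  let ⟨_, hi, hij⟩ := hp.exists_lt
  hp.star.cofactor_lt_single (hS.bijOn.mapsTo hp.left) hi hij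

theorem cofactors_of_criticalPair (hS : IsReductionSystem u I B f)
    (hp : IsCriticalPair u I B j α α' η) :
    u (α ⊔ α' - α) = Finsupp.single j 1 ∧ u (α ⊔ α' - α') = η := by
  obtain ⟨i, hi, hij⟩ := hp.exists_lt
  rw [hS.restr.tsub, hS.restr.tsub, hS.restr.sup,
    hp.star.sup_eq (hS.bijOn.mapsTo hp.left) hi hij]
  exact ⟨add_tsub_cancel_right _ _, by rw [hp.star.1, add_tsub_cancel_left]⟩

theorem rank_lt_of_criticalPair (hS : IsReductionSystem u I B f)
    (hp : IsCriticalPair u I B j α α' η) {γ : Exp n}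
    (hγ : γ ∈ (sPoly ⟨α, f α⟩ ⟨α', f α'⟩).support) :
    rank I (u γ) < ↑(toColex (Finsupp.single j 1)) := by
  obtain ⟨hj, hη⟩ := hS.cofactors_of_criticalPair hp
  rw [mem_support_iff] at hγ
  have hne : γ ≠ α ⊔ α' := by
    rintro rfl
    exact hγ (coeff_sPoly_sup (hS.coeff_head α hp.left) (hS.coeff_head α' hp.right))
  by_cases h0 : (monomial (α ⊔ α' - α) 1 * f α).coeff γ = 0
  · have h0' : (monomial (α ⊔ α' - α') 1 * f α').coeff γ ≠ 0 := by
      intro h0'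
      rw [sPoly, coeff_sub, h0, h0', sub_zero] at hγ
      exact hγ rfl
    refine (hS.rank_lt_of_coeff_monomial_mul_ne_zero hp.right ?_ h0').trans ?_
    · rwa [tsub_add_cancel_of_le le_sup_right]
    · rw [hη, WithBot.coe_lt_coe]
      exact hS.cofactor_lt_of_criticalPair hp
  · rw [← hj]
    refine hS.rank_lt_of_coeff_monomial_mul_ne_zero hp.left ?_ h0
    rwa [tsub_add_cancel_of_le le_sup_left]

theorem monomial_mul_sPoly_mem_span_smallMultiples (hS : IsReductionSystem u I B f)
    (hp : IsCriticalPair u I B j α α' η) {A' : Type*} [CommRing A'] (φ : A →+* A')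
    {f' : Exp n → Poly n A'} (hf : ∀ β ∈ B, f' β = map φ (f β)) (hτ : u τ = 0) {R : Poly n A}
    (hR : Reduces (starMultiples u I B f) (monomial τ 1 * sPoly ⟨α, f α⟩ ⟨α', f α'⟩) R)
    (hφ : map φ R = 0) :
    monomial τ 1 * sPoly ⟨α, f' α⟩ ⟨α', f' α'⟩ ∈ Submodule.span A' (smallMultiples u B f' j) := by
  have hrank : ∀ γ ∈ (monomial τ 1 * sPoly ⟨α, f α⟩ ⟨α', f α'⟩).support,
      (rank I ∘ u) γ < ↑(toColex (Finsupp.single j 1)) := by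
    intro γ hγ
    obtain ⟨δ, rfl, hδ⟩ := exists_of_coeff_monomial_mul_ne_zero (mem_support_iff.1 hγ)
    rw [Function.comp_apply, hS.restr.add, hτ, zero_add]
    exact hS.rank_lt_of_criticalPair hp (mem_support_iff.2 hδ)
  have hmap : monomial τ 1 * sPoly ⟨α, f' α⟩ ⟨α', f' α'⟩ =
      map φ (monomial τ 1 * sPoly ⟨α, f α⟩ ⟨α', f α'⟩ - R) := by
    rw [map_sub, hφ, sub_zero, map_mul, map_monomial, φ.map_one, hf α hp.left, hf α' hp.right,
      sPoly_map]
  rw [hmap]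
  refine map_mem_of_mem_span φ (hS.isUnitriangular.sub_mem_span_rank_lt hR hrank) ?_
  rintro _ ⟨_, ⟨⟨β, hβ, ε, hstar, rfl⟩, hlt⟩, rfl⟩
  refine Submodule.subset_span ⟨β, hβ, ε, ?_, ?_⟩
  · rwa [Function.comp_apply, hS.restr.add, hstar.rank_eq, WithBot.coe_lt_coe] at hlt
  · rw [map_mul, map_monomial, φ.map_one, hf β hβ]

theorem exists_monomial_mul_mem_span_smallMultiples (hS : IsReductionSystem u I B f)
    (hp : IsCriticalPair u I B j α α' η) (hτ : u τ = 0)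
    (hmem : monomial τ 1 * sPoly ⟨α, f α⟩ ⟨α', f α'⟩ ∈
      Submodule.span A (smallMultiples u B f j)) :
    ∃ σ, u σ = 0 ∧
      monomial (σ + Finsupp.single j 1) 1 * f α ∈ Submodule.span A (smallMultiples u B f j) := by
  obtain ⟨hj, hη⟩ := hS.cofactors_of_criticalPair hp
  have hle : Finsupp.single j 1 ≤ α ⊔ α' - α := hj ▸ hS.restr.le _
  refine ⟨τ + (α ⊔ α' - α - Finsupp.single j 1), ?_, ?_⟩
  · rw [hS.restr.add, hτ, hS.restr.tsub, hj, hp.single, tsub_self, zero_add]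
  have hright : monomial τ 1 * (monomial (α ⊔ α' - α') 1 * f α') ∈
      Submodule.span A (smallMultiples u B f j) := by
    refine Submodule.subset_span ⟨α', hp.right, _, ?_, monomial_one_mul_monomial_one_mul _ _ _⟩
    rw [hS.restr.add, hτ, zero_add, hη]
    exact hS.cofactor_lt_of_criticalPair hp
  have hleft := add_mem hmem hright
  rwa [sPoly, mul_sub, sub_add_cancel, monomial_one_mul_monomial_one_mul,
    ← tsub_add_cancel_of_le hle, ← add_assoc] at hleft

theorem monomial_mul_mem_saturatedSpan (hS : IsReductionSystem u I B f)
    (hI : HasStarDecompositions I)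
    (hpair : ∀ j α α' η, IsCriticalPair u I B j α α' η → ∃ τ, u τ = 0 ∧
      monomial τ 1 * sPoly ⟨α, f α⟩ ⟨α', f α'⟩ ∈ Submodule.span A (smallMultiples u B f j))
    (hα : α ∈ B) (ε : Exp n) :
    monomial ε 1 * f α ∈ saturatedSpan I B f hS.restr := by
  induction hk : toColex (u ε) using WellFoundedLT.induction generalizing ε α with
  | ind k ih =>
    subst hk
    by_cases hstar : ∀ i ∈ (u α).support, ∀ j ∈ (u ε).support, j ≤ i
    · exact starSpan_le_saturatedSpan _ (Submodule.subset_span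
        ⟨_, ⟨α, hα, ε, ⟨rfl, hS.bijOn.mapsTo hα, hstar⟩, rfl⟩, rfl⟩)
    push Not at hstar
    obtain ⟨i, hi, j, hj, hij⟩ := hstar
    have huj : u (Finsupp.single j 1) = Finsupp.single j 1 := hS.restr.single hj
    obtain ⟨_, η, hstar⟩ := hI (Finsupp.single j 1 + u α)
      (monomial_mem_of_le (hS.bijOn.mapsTo hα).1 le_add_self)
    obtain ⟨α', hα', rfl⟩ := hS.bijOn.surjOn hstar.2.1
    have hp : IsCriticalPair u I B j α α' η := ⟨hα, hα', huj, ⟨i, hi, hij⟩, hstar⟩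
    obtain ⟨τ, hτ, hmem⟩ := hpair j α α' η hp
    obtain ⟨σ, hσ, hmem⟩ := hS.exists_monomial_mul_mem_span_smallMultiples hp hτ hmem
    obtain ⟨ε, rfl⟩ : ∃ ε', ε = Finsupp.single j 1 + ε' :=
      exists_add_of_le ((Finsupp.single_le_iff.2 (Nat.one_le_iff_ne_zero.2
        (Finsupp.mem_support_iff.1 hj))).trans (hS.restr.le ε))
    refine mem_saturatedSpan_of_monomial_mul hσ ?_
    rw [monomial_one_mul_monomial_one_mul, ← add_assoc, add_comm _ ε,
      ← monomial_one_mul_monomial_one_mul]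
    refine mul_mem_of_mem_span hmem ?_
    rintro _ ⟨β, hβ, ε', hlt, rfl⟩
    rw [monomial_one_mul_monomial_one_mul]
    refine ih _ ?_ hβ _ rfl
    rw [hS.restr.add, hS.restr.add, huj, add_comm (Finsupp.single j 1), toColex_add, toColex_add]
    gcongr

theorem mul_mem_saturatedSpan (hS : IsReductionSystem u I B f)
    (hmul : ∀ α ∈ B, ∀ ε, monomial ε 1 * f α ∈ saturatedSpan I B f hS.restr)
    (p : Poly n A) {h : Poly n A} (hh : h ∈ saturatedSpan I B f hS.restr) :
    p * h ∈ saturatedSpan I B f hS.restr := by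
  induction p using MvPolynomial.induction_on' with
  | monomial ε a =>
    rw [show monomial ε a = a • monomial ε 1 by simp [smul_monomial], smul_mul_assoc]
    refine Submodule.smul_mem _ _ ?_
    obtain ⟨τ, hτ, hspan⟩ := hh
    refine mem_saturatedSpan_of_monomial_mul hτ ?_
    rw [mul_left_comm]
    refine mul_mem_of_mem_span hspan ?_
    rintro _ ⟨_, ⟨α, hα, ε', -, rfl⟩, rfl⟩
    rw [monomial_one_mul_monomial_one_mul]
    exact hmul α hα _
  | add p q hp hq => rw [add_mul]; exact add_mem hp hq

theorem ideal_span_le_saturatedSpan (hS : IsReductionSystem u I B f)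
    (hmul : ∀ α ∈ B, ∀ ε, monomial ε 1 * f α ∈ saturatedSpan I B f hS.restr)
    {s : Set (Poly n A)} (hs : ∀ g ∈ s, g ∈ saturatedSpan I B f hS.restr) {h : Poly n A}
    (hh : h ∈ Ideal.span s) : h ∈ saturatedSpan I B f hS.restr := by
  induction hh using Submodule.span_induction with
  | mem g hg => exact hs g hg
  | zero => exact zero_mem _
  | add g g' _ _ h h' => exact add_mem h h'
  | smul a g _ h => exact hS.mul_mem_saturatedSpan hmul a h

end IsReductionSystem

end Criterion

/-! ### Marked families and their reduction systems -/

section Families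

variable {n : ℕ} {K : Type*} [Field K] {A : Type*} [CommRing A] {J : Ideal (Poly n K)}
  {B : Set (Exp n)}

/-- Over a ring `A`: `p = x^α - ∑ c_γ x^γ`, the sum being over `N(J)_{|α|}`. -/
structure IsMarkedPoly (J : Ideal (Poly n K)) (α : Exp n) (p : Poly n A) : Prop where
  coeff_head : p.coeff α = 1
  tail : ∀ δ, δ ≠ α → p.coeff δ ≠ 0 → δ ∈ sousEscalierDeg J α.degree

/-- The polynomials `f α`, `α ∈ B`, are marked with heads `x^α`; the values of `f` outside `B` are
irrelevant. -/
def IsMarkedFamily (J : Ideal (Poly n K)) (B : Set (Exp n)) (f : Exp n → Poly n A) : Prop :=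
  ∀ α ∈ B, IsMarkedPoly J α (f α)

/-- The marked polynomials `f α` with `α ∈ B`. -/
def markedSet (B : Set (Exp n)) (f : Exp n → Poly n A) : Set (Marked n A) :=
  (fun α => ⟨α, f α⟩) '' B

theorem notMem_sousEscalierDeg {α : Exp n} (hα : α ∈ monomialBasis J) (d : ℕ) :
    α ∉ sousEscalierDeg J d :=
  fun h => (mem_sousEscalierDeg.1 h).2 hα.1

theorem isMarkedPoly_monomial_sub_iff {α : Exp n} (hα : α ∈ monomialBasis J) {q : Poly n A} :
    IsMarkedPoly J α (monomial α 1 - q) ↔ ∀ δ ∈ q.support, δ ∈ sousEscalierDeg J α.degree := by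
  classical
  simp only [mem_support_iff]
  constructor
  · intro hq δ hδ
    have hne : δ ≠ α := by
      rintro rfl
      have hhead := hq.coeff_head
      rw [coeff_sub, coeff_monomial, if_pos rfl, sub_eq_self] at hhead
      exact hδ hhead
    refine hq.tail δ hne ?_
    rwa [coeff_sub, coeff_monomial, if_neg hne.symm, zero_sub, neg_ne_zero]
  · refine fun hq => ⟨?_, fun δ hne hδ => hq δ ?_⟩
    · have h0 : q.coeff α = 0 := not_not.1 fun h => notMem_sousEscalierDeg hα _ (hq α h)
      rw [coeff_sub, coeff_monomial, if_pos rfl, h0, sub_zero]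
    · rwa [coeff_sub, coeff_monomial, if_neg hne.symm, zero_sub, neg_ne_zero] at hδ

namespace IsMarkedPoly

theorem map {A' : Type*} [CommRing A'] {α : Exp n} {p : Poly n A} (hp : IsMarkedPoly J α p)
    (φ : A →+* A') : IsMarkedPoly J α (map φ p) where
  coeff_head := by rw [coeff_map, hp.coeff_head, φ.map_one]
  tail δ hne hδ := by
    refine hp.tail δ hne fun h => hδ ?_
    rw [coeff_map, h, φ.map_zero]

theorem degree_eq {α δ : Exp n} {p : Poly n A} (hp : IsMarkedPoly J α p) (hδ : p.coeff δ ≠ 0) :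
    δ.degree = α.degree := by
  by_cases hne : δ = α
  · rw [hne]
  · exact (mem_sousEscalierDeg.1 (hp.tail δ hne hδ)).1

theorem isHomogeneous {α : Exp n} {p : Poly n A} (hp : IsMarkedPoly J α p) :
    p.IsHomogeneous α.degree := fun δ hδ => by
  have hw : Finsupp.weight 1 δ = δ.degree := by rw [Finsupp.degree_eq_weight_one]; rfl
  exact hw.trans (hp.degree_eq hδ)

end IsMarkedPoly

theorem IsMarkedFamily.map {A' : Type*} [CommRing A'] {f : Exp n → Poly n A}
    (hf : IsMarkedFamily J B f) (φ : A →+* A') :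
    IsMarkedFamily J B (fun α => MvPolynomial.map φ (f α)) :=
  fun α hα => (hf α hα).map φ

section Generic

open Classical in
/-- The generic marked polynomials as a family indexed by all exponents. -/
def genericFamily (J : Ideal (Poly n K)) (B : Set (Exp n)) :
    Exp n → Poly n (MvPolynomial (Param J B) K) :=
  fun α => if h : α ∈ B then (generic J B α h).poly else 0

theorem genericFamily_of_mem {α : Exp n} (h : α ∈ B) :
    genericFamily J B α = (generic J B α h).poly := dif_pos h

theorem genericSet_eq (J : Ideal (Poly n K)) (B : Set (Exp n)) :
    genericSet J B = markedSet B (genericFamily J B) := by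
  have heq {α : Exp n} (hα : α ∈ B) : (⟨α, genericFamily J B α⟩ : Marked n _) = generic J B α hα :=
    by rw [genericFamily_of_mem hα]; rfl
  ext F
  constructor
  · rintro ⟨α, hα, rfl⟩
    exact ⟨α, hα, heq hα⟩
  · rintro ⟨α, hα, rfl⟩
    exact ⟨α, hα, heq hα⟩

theorem isMarkedFamily_generic (hB : B ⊆ monomialBasis J) :
    IsMarkedFamily J B (genericFamily J B) := by
  classical
  intro α hα
  rw [genericFamily_of_mem hα, generic, isMarkedPoly_monomial_sub_iff (hB hα)]
  intro δ hδ
  rw [mem_support_iff, coeff_sum] at hδ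
  obtain ⟨γ, -, hγ⟩ := Finset.exists_ne_zero_of_sum_ne_zero hδ
  rw [coeff_monomial] at hγ
  exact (ite_ne_right_iff.1 hγ).1 ▸ γ.2

theorem coeff_generic_param (hB : B ⊆ monomialBasis J) (c : Param J B) :
    (genericFamily J B c.1.1).coeff c.1.2 = -X c := by
  classical
  obtain ⟨⟨α, δ⟩, hα, hδ⟩ := c
  have hne : α ≠ δ := by
    rintro rfl
    exact notMem_sousEscalierDeg (hB hα) _ hδ
  rw [genericFamily_of_mem hα, generic, coeff_sub, coeff_monomial, if_neg hne, zero_sub, neg_inj,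
    coeff_sum, Finset.sum_eq_single_of_mem ⟨δ, hδ⟩ (Finset.mem_attach _ _)]
  · rw [coeff_monomial, if_pos rfl]
  · intro γ _ hγ
    rw [coeff_monomial, if_neg fun h => hγ (Subtype.ext h)]

theorem hom_ext_of_map_genericFamily (hB : B ⊆ monomialBasis J)
    {φ ψ : MvPolynomial (Param J B) K →+* A} (hC : ∀ a, φ (C a) = ψ (C a))
    (h : ∀ α ∈ B, map φ (genericFamily J B α) = map ψ (genericFamily J B α)) : φ = ψ := by
  refine ringHom_ext hC fun c => ?_
  have hc := congrArg (coeff c.1.2) (h _ c.2.1)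
  rwa [coeff_map, coeff_map, coeff_generic_param hB, φ.map_neg, ψ.map_neg, neg_inj] at hc

/-- The specialization of the parameters that turns the generic family into `f`. -/
def familyHom (J : Ideal (Poly n K)) (B : Set (Exp n)) (φ : K →+* A) (f : Exp n → Poly n A) :
    MvPolynomial (Param J B) K →+* A :=
  eval₂Hom φ fun c => -(f c.1.1).coeff c.1.2

theorem familyHom_X (φ : K →+* A) (f : Exp n → Poly n A) (c : Param J B) :
    familyHom J B φ f (X c) = -(f c.1.1).coeff c.1.2 :=
  eval₂Hom_X' _ _ _

theorem map_familyHom (hB : B ⊆ monomialBasis J) (φ : K →+* A) {f : Exp n → Poly n A}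
    (hf : IsMarkedFamily J B f) {α : Exp n} (hα : α ∈ B) :
    map (familyHom J B φ f) (genericFamily J B α) = f α := by
  have hgen := isMarkedFamily_generic hB α hα
  ext δ
  rw [coeff_map]
  by_cases hne : δ = α
  · rw [hne, hgen.coeff_head, (hf α hα).coeff_head, map_one]
  by_cases hδ : δ ∈ sousEscalierDeg J α.degree
  · have hX := familyHom_X φ f (⟨(α, δ), hα, hδ⟩ : Param J B)
    rw [coeff_generic_param hB ⟨(α, δ), hα, hδ⟩, map_neg, hX, neg_neg]
  · rw [not_not.1 fun h => hδ ((hf α hα).tail δ hne h),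
      not_not.1 fun h => hδ (hgen.tail δ hne h), map_zero]

end Generic

theorem isRestriction_id : IsRestriction (id : Exp n → Exp n) :=
  fun _ => .inl fun _ => rfl

theorem isRestriction_under : IsRestriction (under : Exp n → Exp n) := fun i => by
  by_cases hi : i = 0
  · exact .inr fun α => by rw [under_apply, if_pos hi]
  · exact .inl fun α => by rw [under_apply, if_neg hi]

theorem IsMarkedFamily.isReductionSystem_id {f : Exp n → Poly n A}
    (hf : IsMarkedFamily J (monomialBasis J) f) :
    IsReductionSystem id J (monomialBasis J) f where
  restr := isRestriction_id
  bijOn := Set.bijOn_id _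
  coeff_head α hα := (hf α hα).coeff_head
  tail α hα δ hne hδ := (mem_sousEscalierDeg.1 ((hf α hα).tail δ hne hδ)).2

theorem IsUnderTruncation.notMem {m : ℕ} (hJ : IsUnderTruncation m J) {α δ : Exp n}
    (hα : α ∈ monomialBasis J) (hδ : δ ∈ sousEscalierDeg J α.degree) :
    monomial δ (1 : K) ∉ underIdeal J := by
  intro h
  obtain ⟨hd, hN⟩ := mem_sousEscalierDeg.1 hδ
  exact hN ((hJ δ).2 ⟨h, hd ▸ ((hJ α).1 hα.1).2⟩)

theorem IsMarkedFamily.isReductionSystem_under {m : ℕ} (hJ : IsUnderTruncation m J)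
    {f : Exp n → Poly n A} (hf : IsMarkedFamily J (superminimals J) f) :
    IsReductionSystem under (underIdeal J) (superminimals J) f where
  restr := isRestriction_under
  bijOn := ⟨fun _ hα => hα.2, (injOn_under_monomialBasis J).mono (superminimals_subset J),
    fun _ hβ => exists_superminimal hβ⟩
  coeff_head α hα := (hf α hα).coeff_head
  tail α hα δ hne hδ := by
    rw [monomial_under_mem_underIdeal_iff]
    exact hJ.notMem hα.1 ((hf α hα).tail δ hne hδ)

theorem vStep_markedSet (f : Exp n → Poly n A) :
    VStep (markedSet (monomialBasis J) f) =
      ReductionStep (starMultiples id J (monomialBasis J) f) := by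
  ext h h₁
  constructor
  · rintro ⟨_, ⟨α, hα, rfl⟩, δ, hstar, hmem, rfl⟩
    refine ⟨_, ⟨α, hα, δ, ⟨rfl, hα, hstar⟩, rfl⟩, ?_, ?_⟩
    · rwa [add_comm δ] at hmem
    · rw [← mul_assoc, C_mul_monomial, mul_one, add_comm α δ]
  · rintro ⟨_, ⟨α, hα, δ, hstar, rfl⟩, hmem, rfl⟩
    refine ⟨_, ⟨α, hα, rfl⟩, δ, hstar.2.2, ?_, ?_⟩
    · rwa [add_comm α δ] at hmem
    · rw [← mul_assoc, C_mul_monomial, mul_one, add_comm α δ]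

theorem isStar_under_add_iff {α ε η : Exp n} (h : α + ε = under α + η) :
    IsStar J (α + ε) (under α) η ↔ IsStar J (under α + under ε) (under α) (under ε) := by
  have hη : η = ε + Finsupp.single 0 (α 0) := by
    refine add_left_cancel (a := under α) ?_
    rw [← h, add_left_comm, under_add_single_zero, add_comm]
  refine ⟨fun hstar => ⟨rfl, hstar.2.1, fun i hi j hj => hstar.2.2 i hi j ?_⟩,
    fun hstar => ⟨h, hstar.2.1, fun i hi j hj => ?_⟩⟩
  · rw [hη, Finsupp.mem_support_iff, Finsupp.add_apply]
    rw [Finsupp.mem_support_iff, under_apply] at hj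
    split_ifs at hj
    · exact absurd rfl hj
    · lia
  · by_cases h0 : j = 0
    · rw [h0]
      exact Fin.zero_le _
    · refine hstar.2.2 i hi j ?_
      rw [hη, Finsupp.mem_support_iff, Finsupp.add_apply, Finsupp.single_eq_of_ne h0,
        add_zero] at hj
      rwa [Finsupp.mem_support_iff, under_apply, if_neg h0]

theorem sgStep_markedSet (f : Exp n → Poly n A) :
    SGStep J (markedSet (superminimals J) f) =
      ReductionStep (starMultiples under (underIdeal J) (superminimals J) f) := by
  ext h h₁
  constructor
  · rintro ⟨_, hγ, -, _, ⟨α, hα, rfl⟩, η, ε, hstar, rfl, rfl⟩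
    refine ⟨_, ⟨α, hα, ε, (isStar_under_add_iff hstar.1).1 hstar, rfl⟩, hγ, ?_⟩
    rw [← mul_assoc, C_mul_monomial, mul_one]
  · rintro ⟨_, ⟨α, hα, ε, hstar, rfl⟩, hmem, rfl⟩
    have heq : α + ε = under α + (ε + Finsupp.single 0 (α 0)) := by
      rw [add_left_comm, under_add_single_zero, add_comm]
    refine ⟨α + ε, hmem, monomial_mem_of_le hα.1.1 le_self_add, _, ⟨α, hα, rfl⟩, _, ε,
      (isStar_under_add_iff heq).2 hstar, rfl, ?_⟩
    rw [← mul_assoc, C_mul_monomial, mul_one]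

theorem sgReduces_markedSet (f : Exp n → Poly n A) :
    SGReduces J (markedSet (superminimals J) f) =
      Reduces (starMultiples under (underIdeal J) (superminimals J) f) := by
  rw [SGReduces, sgStep_markedSet]

theorem under_eq_zero_iff {τ : Exp n} : under τ = 0 ↔ ∃ t : ℕ, τ = Finsupp.single 0 t := by
  constructor
  · intro h
    refine ⟨τ 0, ?_⟩
    conv_lhs => rw [← under_add_single_zero τ, h, zero_add]
  · rintro ⟨t, rfl⟩
    exact under_single_zero t

theorem stronglyReduced_iff {m : ℕ} (hss : IsStronglyStable J) (hJ : IsUnderTruncation m J)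
    {f : Exp n → Poly n A} (hf : IsMarkedFamily J (superminimals J) f) {h : Poly n A} :
    StronglyReduced J (markedSet (superminimals J) f) h ↔
      ∀ γ ∈ h.support, monomial γ (1 : K) ∉ underIdeal J := by
  have hS := hf.isReductionSystem_under hJ
  simp only [StronglyReduced, NonReducible, sgStep_markedSet, X_pow_eq_monomial]
  constructor
  · intro hred γ hγ hmem
    obtain ⟨τ, hτ, q, hq, hqh⟩ := hS.exists_starMultiple hss.underIdeal.hasStarDecompositions
      (monomial_under_mem_underIdeal_iff.2 hmem)
    obtain ⟨t, rfl⟩ := under_eq_zero_iff.1 hτ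
    refine hred t _ ⟨q, hq, ?_, rfl⟩
    rw [hqh, mem_support_iff, coeff_monomial_mul, one_mul]
    exact mem_support_iff.1 hγ
  · rintro hred t _ ⟨_, ⟨α, -, ε, hstar, rfl⟩, hmem, -⟩
    obtain ⟨δ, hδ : α + ε = _, hδh⟩ :=
      exists_of_coeff_monomial_mul_ne_zero (mem_support_iff.1 hmem)
    refine hred δ (mem_support_iff.2 hδh) (monomial_under_mem_underIdeal_iff.1 ?_)
    have hmem := hstar.mem
    rwa [← under_add, hδ, under_add, under_single_zero, zero_add] at hmem

theorem Reduces.isHomogeneous {P : Set (Marked n A)}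
    (hP : ∀ q ∈ P, q.poly.IsHomogeneous q.head.degree) {h R : Poly n A} (hR : Reduces P h R) {d : ℕ}
    (hh : h.IsHomogeneous d) : R.IsHomogeneous d := by
  induction hR with
  | refl => exact hh
  | tail _ hstep ih =>
    obtain ⟨q, hq, hmem, rfl⟩ := hstep
    have hdeg : q.head.degree = d := by
      rw [Finsupp.degree_eq_weight_one]
      exact ih (mem_support_iff.1 hmem)
    exact ih.sub (hdeg ▸ (hP q hq).C_mul _)

theorem IsMarkedFamily.isHomogeneous_starMultiples {u : Exp n → Exp n} {I : Ideal (Poly n K)}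
    {f : Exp n → Poly n A} (hf : IsMarkedFamily J B f) :
    ∀ q ∈ starMultiples u I B f, q.poly.IsHomogeneous q.head.degree := by
  rintro _ ⟨α, hα, ε, -, rfl⟩
  change (monomial ε 1 * f α).IsHomogeneous (α + ε).degree
  rw [add_comm α, map_add]
  exact (isHomogeneous_monomial 1 rfl).mul (hf α hα).isHomogeneous

end Families

/-! ### Marked bases and superminimal reduction -/

section Bases

variable {n : ℕ} {K : Type*} [Field K] {A : Type*} [CommRing A] {J : Ideal (Poly n K)}

/-- The monomials outside `J` are linearly independent modulo the ideal generated by the `f α`.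
For a marked family they span the quotient in any case. -/
def IsMarkedBasis (J : Ideal (Poly n K)) (f : Exp n → Poly n A) : Prop :=
  ∀ h ∈ Ideal.span (f '' monomialBasis J), IsReduced J h → h = 0

theorem isReduced_sub {h h' : Poly n A} (hh : IsReduced J h) (hh' : IsReduced J h') :
    IsReduced J (h - h') :=
  (restrictSupport A (sousEscalier J)).sub_mem hh hh'

theorem isReduced_map {A' : Type*} [CommRing A'] (φ : A →+* A') {h : Poly n A}
    (hh : IsReduced J h) : IsReduced J (map φ h) :=
  fun γ hγ => hh γ (support_map_subset φ h hγ)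

theorem isReduced_of_forall_notMem_underIdeal {h : Poly n A}
    (hh : ∀ γ ∈ h.support, monomial γ (1 : K) ∉ underIdeal J) : IsReduced J h :=
  fun γ hγ hmem => hh γ hγ (monomial_mem_underIdeal hmem)

theorem map_eq_zero_iff_coeffs {σ A' : Type*} [CommRing A'] (φ : A →+* A')
    {R : MvPolynomial σ A} : map φ R = 0 ↔ ∀ c ∈ R.coeffs, φ c = 0 := by
  refine ⟨fun h c hc => ?_, fun h => ?_⟩
  · obtain ⟨γ, -, rfl⟩ := mem_coeffs_iff.1 hc
    rw [← coeff_map, h, coeff_zero]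
  · ext γ
    rw [coeff_map, coeff_zero]
    by_cases h0 : R.coeff γ = 0
    · rw [h0, map_zero]
    · exact h _ (coeff_mem_coeffs γ h0)

theorem starSpan_le_ideal_span (u : Exp n → Exp n) (I : Ideal (Poly n K)) (B : Set (Exp n))
    (f : Exp n → Poly n A) :
    starSpan u I B f ≤ (Ideal.span (f '' B)).restrictScalars A := by
  refine Submodule.span_le.2 ?_
  rintro _ ⟨_, ⟨α, hα, ε, -, rfl⟩, rfl⟩
  exact Ideal.mul_mem_left _ _ (Ideal.subset_span ⟨α, hα, rfl⟩)

theorem map_mem_ideal_span {A' : Type*} [CommRing A'] (φ : A →+* A') {B B' : Set (Exp n)}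
    {f : Exp n → Poly n A} {f' : Exp n → Poly n A'} (hB : B ⊆ B')
    (hf : ∀ α ∈ B, f' α = map φ (f α)) {h : Poly n A} (hh : h ∈ Ideal.span (f '' B)) :
    map φ h ∈ Ideal.span (f' '' B') := by
  have hmem := Ideal.mem_map_of_mem (MvPolynomial.map φ) hh
  rw [Ideal.map_span] at hmem
  refine Ideal.span_mono ?_ hmem
  rintro _ ⟨_, ⟨α, hα, rfl⟩, rfl⟩
  exact ⟨α, hB hα, hf α hα⟩

theorem sPoly_mem_ideal_span {B : Set (Exp n)} {f : Exp n → Poly n A} {α α' : Exp n} (hα : α ∈ B)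
    (hα' : α' ∈ B) : sPoly ⟨α, f α⟩ ⟨α', f α'⟩ ∈ Ideal.span (f '' B) :=
  sub_mem (Ideal.mul_mem_left _ _ (Ideal.subset_span ⟨α, hα, rfl⟩))
    (Ideal.mul_mem_left _ _ (Ideal.subset_span ⟨α', hα', rfl⟩))

theorem le_degree_of_mem_ideal_span {m : ℕ} {s : Set (Poly n A)}
    (hs : ∀ p ∈ s, ∀ γ ∈ p.support, m ≤ γ.degree) {h : Poly n A} (hh : h ∈ Ideal.span s) :
    ∀ γ ∈ h.support, m ≤ γ.degree := by
  have hle : Ideal.span s ≤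
      Ideal.span ((fun γ => monomial γ (1 : A)) '' {γ : Exp n | m ≤ γ.degree}) :=
    Ideal.span_le.2 fun p hp =>
      mem_ideal_span_monomial_image.2 fun γ hγ => ⟨γ, hs p hp γ hγ, le_rfl⟩
  intro γ hγ
  obtain ⟨δ, hδ, hδγ⟩ := mem_ideal_span_monomial_image.1 (hle hh) γ hγ
  exact le_trans hδ (Finsupp.degree_mono hδγ)

theorem IsMarkedFamily.exists_reduces (hss : IsStronglyStable J) {f : Exp n → Poly n A}
    (hf : IsMarkedFamily J (monomialBasis J) f) (h : Poly n A) :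
    ∃ R, Reduces (starMultiples id J (monomialBasis J) f) h R ∧ IsReduced J R := by
  obtain ⟨_, rfl, R, hR, hred⟩ :=
    hf.isReductionSystem_id.exists_reduces hss.hasStarDecompositions h
  rw [← C_apply, C_1, one_mul] at hR
  exact ⟨R, hR, hred⟩

theorem IsMarkedBasis.idealA_le_ker {φ : MvPolynomial (ParamC J) K →+* A}
    (hb : IsMarkedBasis J fun α => map φ (genericFamily J (monomialBasis J) α)) :
    idealA J ≤ RingHom.ker φ := by
  refine Ideal.span_le.2 ?_
  rintro c ⟨F, hF, F', hF', R, hR, hred, hc⟩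
  rw [genericSet_eq] at hF hF' hR
  rw [vStep_markedSet] at hR
  obtain ⟨α, hα, rfl⟩ := hF
  obtain ⟨α', hα', rfl⟩ := hF'
  have hmem := sub_mem (sPoly_mem_ideal_span (f := genericFamily J (monomialBasis J)) hα hα')
    (starSpan_le_ideal_span _ _ _ _ (Reduces.sub_mem_span hR))
  rw [sub_sub_cancel] at hmem
  have h0 := hb _ (map_mem_ideal_span φ subset_rfl (fun _ _ => rfl) hmem) (isReduced_map φ hred)
  exact (map_eq_zero_iff_coeffs φ).1 h0 c hc

theorem isMarkedBasis_of_idealA_le_ker (hss : IsStronglyStable J)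
    {φ : MvPolynomial (ParamC J) K →+* A} (hφ : idealA J ≤ RingHom.ker φ) :
    IsMarkedBasis J fun α => map φ (genericFamily J (monomialBasis J) α) := by
  have hgen := isMarkedFamily_generic (J := J) subset_rfl
  have hS₀ := hgen.isReductionSystem_id
  have hS := (hgen.map φ).isReductionSystem_id
  have hmul : ∀ α ∈ monomialBasis J, ∀ ε, _ := fun α hα ε =>
    hS.monomial_mul_mem_saturatedSpan hss.hasStarDecompositions (fun j α α' η hp => by
      obtain ⟨R, hR, hred⟩ := hgen.exists_reduces hss
        (sPoly ⟨α, genericFamily J (monomialBasis J) α⟩ ⟨α', genericFamily J (monomialBasis J) α'⟩)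
      refine ⟨0, rfl, hS₀.monomial_mul_sPoly_mem_span_smallMultiples (R := R) hp φ
        (fun _ _ => rfl) rfl (by rwa [← C_apply, C_1, one_mul]) ?_⟩
      refine (map_eq_zero_iff_coeffs φ).2 fun c hc => hφ (Ideal.subset_span ?_)
      rw [genericSet_eq, vStep_markedSet]
      exact ⟨_, ⟨α, hp.left, rfl⟩, _, ⟨α', hp.right, rfl⟩, R, hR, hred, hc⟩) hα ε
  intro h hh hred
  refine hS.eq_zero_of_mem_saturatedSpan (hS.ideal_span_le_saturatedSpan hmul ?_ hh) hred
  rintro _ ⟨α, hα, rfl⟩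
  have hmem := hmul α hα 0
  rwa [← C_apply, C_1, one_mul] at hmem

/-- `x_0^t H` has a superminimal reduction to the strongly reduced polynomial `R`; the exponent `t`
need not be minimal. -/
def IsStrongReduct (J : Ideal (Poly n K)) (sG : Set (Marked n A)) (H : Poly n A) (t : ℕ)
    (R : Poly n A) : Prop :=
  SGReduces J sG (X 0 ^ t * H) R ∧ StronglyReduced J sG R

variable {m : ℕ}

theorem exists_isStrongReduct (hss : IsStronglyStable J) (hJ : IsUnderTruncation m J)
    {f : Exp n → Poly n A} (hf : IsMarkedFamily J (superminimals J) f) (H : Poly n A) :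
    ∃ t R, IsStrongReduct J (markedSet (superminimals J) f) H t R := by
  obtain ⟨τ, hτ, R, hR, hred⟩ :=
    (hf.isReductionSystem_under hJ).exists_reduces hss.underIdeal.hasStarDecompositions H
  obtain ⟨t, rfl⟩ := under_eq_zero_iff.1 hτ
  refine ⟨t, R, ?_, (stronglyReduced_iff hss hJ hf).2 fun γ hγ h => hred γ hγ ?_⟩
  · rwa [sgReduces_markedSet, X_pow_eq_monomial]
  · exact monomial_under_mem_underIdeal_iff.2 h

theorem exists_isStrongReduct_genericSet (hss : IsStronglyStable J) (hJ : IsUnderTruncation m J)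
    (H : Poly n (Coef J)) :
    ∃ t R, IsStrongReduct J (genericSet J (superminimals J)) H t R := by
  rw [genericSet_eq]
  exact exists_isStrongReduct hss hJ (isMarkedFamily_generic (superminimals_subset J)) H

section Extension

variable {φ : Coef J →+* A} {f : Exp n → Poly n A} {t : ℕ} {R : Poly n (Coef J)}

/-- The superminimal members of the family `f` are the specializations by `φ` of the generic
ones. -/
def ExtendsSpecialization (φ : Coef J →+* A) (f : Exp n → Poly n A) : Prop :=
  ∀ α ∈ superminimals J, f α = map φ (genericFamily J (superminimals J) α)

theorem IsStrongReduct.notMem_underIdeal (hss : IsStronglyStable J) (hJ : IsUnderTruncation m J)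
    {H : Poly n (Coef J)} (hR : IsStrongReduct J (genericSet J (superminimals J)) H t R) :
    ∀ γ ∈ R.support, monomial γ (1 : K) ∉ underIdeal J := by
  have hred := hR.2
  rwa [genericSet_eq,
    stronglyReduced_iff hss hJ (isMarkedFamily_generic (superminimals_subset J))] at hred

theorem IsStrongReduct.isReduced_map (hss : IsStronglyStable J) (hJ : IsUnderTruncation m J)
    {H : Poly n (Coef J)} (hR : IsStrongReduct J (genericSet J (superminimals J)) H t R)
    (φ : Coef J →+* A) : IsReduced J (map φ R) :=
  MarkedScheme.isReduced_map φ
    (isReduced_of_forall_notMem_underIdeal (hR.notMem_underIdeal hss hJ))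

theorem ExtendsSpecialization.sub_map_mem (hext : ExtendsSpecialization φ f) {H : Poly n (Coef J)}
    (hR : IsStrongReduct J (genericSet J (superminimals J)) H t R) :
    X 0 ^ t * map φ H - map φ R ∈ Ideal.span (f '' monomialBasis J) := by
  have hred := hR.1
  rw [genericSet_eq, sgReduces_markedSet] at hred
  have hmem := map_mem_ideal_span φ (superminimals_subset J) hext
    (starSpan_le_ideal_span _ _ _ _ hred.sub_mem_span)
  rwa [map_sub, map_mul, map_pow, map_X] at hmem

theorem IsMarkedPoly.mem_sousEscalierDeg_of_mem_support_monomial_sub {α δ : Exp n}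
    (hα : α ∈ monomialBasis J) {p : Poly n A} (hp : IsMarkedPoly J α p)
    (hδ : δ ∈ (monomial α 1 - p).support) : δ ∈ sousEscalierDeg J α.degree :=
  (isMarkedPoly_monomial_sub_iff hα).1 ((sub_sub_cancel (monomial α 1) p).symm ▸ hp) δ hδ

theorem isReduced_X_pow_mul_sub (hJ : IsUnderTruncation m J) {α : Exp n}
    (hα : α ∈ monomialBasis J) {p : Poly n A} (hp : IsMarkedPoly J α p) (t : ℕ) :
    IsReduced J (X 0 ^ t * (monomial α 1 - p)) := by
  refine isReduced_of_forall_notMem_underIdeal fun γ hγ hmem => ?_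
  rw [X_pow_eq_monomial, mem_support_iff] at hγ
  obtain ⟨δ, rfl, hδ⟩ := exists_of_coeff_monomial_mul_ne_zero hγ
  rw [← monomial_under_mem_underIdeal_iff, under_add, under_single_zero, zero_add,
    monomial_under_mem_underIdeal_iff] at hmem
  exact hJ.notMem hα
    (hp.mem_sousEscalierDeg_of_mem_support_monomial_sub hα (mem_support_iff.2 hδ)) hmem

namespace IsMarkedBasis

theorem map_strongReduct_monomial (hss : IsStronglyStable J) (hJ : IsUnderTruncation m J)
    (hf : IsMarkedFamily J (monomialBasis J) f) (hb : IsMarkedBasis J f)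
    (hext : ExtendsSpecialization φ f) {α : Exp n} (hα : α ∈ monomialBasis J)
    (hR : IsStrongReduct J (genericSet J (superminimals J)) (monomial α 1) t R) :
    map φ R = X 0 ^ t * (monomial α 1 - f α) := by
  refine sub_eq_zero.1 (hb _ ?_
    (isReduced_sub (hR.isReduced_map hss hJ φ) (isReduced_X_pow_mul_sub hJ hα (hf α hα) t)))
  have hmem := sub_mem
    (Ideal.mul_mem_left (Ideal.span (f '' monomialBasis J)) (X 0 ^ t)
      (Ideal.subset_span ⟨α, hα, rfl⟩)) (hext.sub_map_mem hR)
  rw [map_monomial, φ.map_one] at hmem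
  convert hmem using 1
  ring

theorem map_strongReduct_sPoly (hss : IsStronglyStable J) (hJ : IsUnderTruncation m J)
    (hb : IsMarkedBasis J f) (hext : ExtendsSpecialization φ f) {F F' : Marked n (Coef J)}
    (hF : F ∈ genericSet J (superminimals J)) (hF' : F' ∈ genericSet J (superminimals J))
    (hR : IsStrongReduct J (genericSet J (superminimals J)) (sPoly F F') t R) :
    map φ R = 0 := by
  refine hb _ ?_ (hR.isReduced_map hss hJ φ)
  rw [genericSet_eq] at hF hF'
  obtain ⟨α, hα, rfl⟩ := hF
  obtain ⟨α', hα', rfl⟩ := hF'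
  have hS := map_mem_ideal_span φ (superminimals_subset J) hext (sPoly_mem_ideal_span hα hα')
  have hmem := sub_mem (Ideal.mul_mem_left _ (X 0 ^ t) hS) (hext.sub_map_mem hR)
  rwa [sub_sub_cancel] at hmem

theorem unique (hss : IsStronglyStable J) (hJ : IsUnderTruncation m J)
    {f' : Exp n → Poly n A} (hf : IsMarkedFamily J (monomialBasis J) f)
    (hf' : IsMarkedFamily J (monomialBasis J) f') (hb : IsMarkedBasis J f)
    (hb' : IsMarkedBasis J f') (hext : ExtendsSpecialization φ f)
    (hext' : ExtendsSpecialization φ f') :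
    ∀ α ∈ monomialBasis J, f α = f' α := by
  intro α hα
  obtain ⟨t, R, hR⟩ := exists_isStrongReduct_genericSet hss hJ (monomial α 1)
  have heq := (hb.map_strongReduct_monomial hss hJ hf hext hα hR).symm.trans
    (hb'.map_strongReduct_monomial hss hJ hf' hext' hα hR)
  rw [X_pow_eq_monomial] at heq
  exact sub_right_inj.1 (monomial_one_mul_cancel_left_iff.1 heq)

end IsMarkedBasis

/-- `φ` annihilates the equations found by the algorithm `markedScheme`. -/
structure KillsEquations (J : Ideal (Poly n K)) (φ : Coef J →+* A) : Prop where
  gens : ∀ α ∈ monomialBasis J \ superminimals J, ∃ t R,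
    IsStrongReduct J (genericSet J (superminimals J)) (monomial α 1) t R ∧
      ∀ c ∈ (R.modMonomial (Finsupp.single 0 t)).coeffs, φ c = 0
  pairs : ∀ p ∈ pairsL1 J (genericSet J (superminimals J)), ∃ t R,
    IsStrongReduct J (genericSet J (superminimals J)) (sPoly p.1 p.2) t R ∧
      ∀ c ∈ R.coeffs, φ c = 0

/-- The polynomials `g` such that `x_0^t g`, for some `t`, is a combination of star multiples of the
specialized superminimal polynomials. -/
abbrev superminimalSpan (φ : Coef J →+* A) : Submodule A (Poly n A) :=
  saturatedSpan (underIdeal J) (superminimals J)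
    (fun α => map φ (genericFamily J (superminimals J) α)) isRestriction_under

theorem isMarkedBasis_of_mem_superminimalSpan (hJ : IsUnderTruncation m J)
    (hf : IsMarkedFamily J (monomialBasis J) f)
    (hmul : ∀ α ∈ superminimals J, ∀ ε,
      monomial ε 1 * map φ (genericFamily J (superminimals J) α) ∈ superminimalSpan φ)
    (hmem : ∀ α ∈ monomialBasis J, f α ∈ superminimalSpan φ) :
    IsMarkedBasis J f := by
  intro h hh hred
  have hS := ((isMarkedFamily_generic (superminimals_subset J)).map φ).isReductionSystem_under hJ
  have hspan := hS.ideal_span_le_saturatedSpan hmul (Set.forall_mem_image.2 hmem) hh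
  -- In degrees at least `m`, the ideals `J` and `underIdeal J` contain the same monomials.
  have hdeg := le_degree_of_mem_ideal_span (m := m) (Set.forall_mem_image.2 fun α hα γ hγ =>
    ((hJ α).1 hα.1).2.trans_eq ((hf α hα).degree_eq (mem_support_iff.1 hγ)).symm) hh
  exact hS.eq_zero_of_mem_saturatedSpan hspan fun γ hγ hγJ =>
    hred γ hγ ((hJ γ).2 ⟨monomial_under_mem_underIdeal_iff.1 hγJ, hdeg γ hγ⟩)

theorem IsStrongReduct.isMarkedPoly (hss : IsStronglyStable J) (hJ : IsUnderTruncation m J)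
    {α : Exp n} (hα : α ∈ monomialBasis J)
    (hR : IsStrongReduct J (genericSet J (superminimals J)) (monomial α 1) t R) :
    IsMarkedPoly J α (monomial α 1 - R.divMonomial (Finsupp.single 0 t)) := by
  have hred := hR.1
  rw [genericSet_eq, sgReduces_markedSet, X_pow_eq_monomial, monomial_mul] at hred
  have hhom := hred.isHomogeneous
    (isMarkedFamily_generic (superminimals_subset J)).isHomogeneous_starMultiples
    (isHomogeneous_monomial _ rfl)
  rw [isMarkedPoly_monomial_sub_iff hα]
  intro δ hδ
  rw [mem_support_iff, coeff_divMonomial] at hδ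
  refine mem_sousEscalierDeg.2 ⟨?_, fun hδJ => ?_⟩
  · have hdeg := not_not.1 (mt hhom.coeff_eq_zero hδ)
    rw [map_add, map_add] at hdeg
    exact add_left_cancel hdeg
  · exact hR.notMem_underIdeal hss hJ _ (mem_support_iff.2 hδ)
      (monomial_mem_underIdeal (monomial_mem_of_le hδJ le_add_self))

theorem IsStrongReduct.map_monomial_sub_mem {α : Exp n}
    (hR : IsStrongReduct J (genericSet J (superminimals J)) (monomial α 1) t R)
    (hφ : ∀ c ∈ (R.modMonomial (Finsupp.single 0 t)).coeffs, φ c = 0) :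
    map φ (monomial α 1 - R.divMonomial (Finsupp.single 0 t)) ∈ superminimalSpan φ := by
  have hred := hR.1
  rw [genericSet_eq, sgReduces_markedSet, X_pow_eq_monomial] at hred
  refine ⟨Finsupp.single 0 t, under_single_zero t, ?_⟩
  have hR0 : map φ R = map φ (monomial (Finsupp.single 0 t) 1 *
      R.divMonomial (Finsupp.single 0 t)) := by
    conv_lhs => rw [← divMonomial_add_modMonomial R (Finsupp.single 0 t), map_add,
      (map_eq_zero_iff_coeffs φ).2 hφ, add_zero]
  have hmem : map φ (monomial (Finsupp.single 0 t) 1 * monomial α 1 - R) ∈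
      starSpan under (underIdeal J) (superminimals J)
        (fun α => map φ (genericFamily J (superminimals J) α)) := by
    refine map_mem_of_mem_span φ hred.sub_mem_span ?_
    rintro _ ⟨_, ⟨α, hα, ε, hstar, rfl⟩, rfl⟩
    refine Submodule.subset_span ⟨_, ⟨α, hα, ε, hstar, rfl⟩, ?_⟩
    rw [map_mul, map_monomial, φ.map_one]
  rwa [map_sub, hR0, ← map_sub, ← mul_sub, map_mul, map_monomial, φ.map_one] at hmem

namespace KillsEquations

theorem monomial_mul_mem_superminimalSpan (hss : IsStronglyStable J) (hJ : IsUnderTruncation m J)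
    (hφ : KillsEquations J φ) {α : Exp n} (hα : α ∈ superminimals J) (ε : Exp n) :
    monomial ε 1 * map φ (genericFamily J (superminimals J) α) ∈ superminimalSpan φ := by
  have hgen := isMarkedFamily_generic (superminimals_subset J)
  refine ((hgen.map φ).isReductionSystem_under hJ).monomial_mul_mem_saturatedSpan
    hss.underIdeal.hasStarDecompositions (fun j α α' η hp => ?_) hα ε
  have hL1 : ((⟨α, genericFamily J (superminimals J) α⟩,
      ⟨α', genericFamily J (superminimals J) α'⟩) : Marked n (Coef J) × Marked n (Coef J)) ∈
      pairsL1 J (genericSet J (superminimals J)) := by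
    rw [genericSet_eq]
    exact ⟨⟨α, hp.left, rfl⟩, ⟨α', hp.right, rfl⟩, j, η, hp.star⟩
  obtain ⟨t, R, ⟨hR, -⟩, hc⟩ := hφ.pairs _ hL1
  rw [genericSet_eq, sgReduces_markedSet, X_pow_eq_monomial] at hR
  exact ⟨Finsupp.single 0 t, under_single_zero t,
    (hgen.isReductionSystem_under hJ).monomial_mul_sPoly_mem_span_smallMultiples hp φ
      (fun _ _ => rfl) (under_single_zero t) hR ((map_eq_zero_iff_coeffs φ).2 hc)⟩

theorem exists_isMarkedPoly (hss : IsStronglyStable J) (hJ : IsUnderTruncation m J)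
    (hφ : KillsEquations J φ) {α : Exp n} (hα : α ∈ monomialBasis J) :
    ∃ p : Poly n A, IsMarkedPoly J α p ∧ p ∈ superminimalSpan φ ∧
      (α ∈ superminimals J → p = map φ (genericFamily J (superminimals J) α)) := by
  by_cases hs : α ∈ superminimals J
  · refine ⟨_, (isMarkedFamily_generic (superminimals_subset J) α hs).map φ, ?_, fun _ => rfl⟩
    have hmem := hφ.monomial_mul_mem_superminimalSpan hss hJ hs 0
    rwa [← C_apply, C_1, one_mul] at hmem
  · obtain ⟨t, R, hR, hc⟩ := hφ.gens α ⟨hα, hs⟩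
    exact ⟨_, (hR.isMarkedPoly hss hJ hα).map φ, hR.map_monomial_sub_mem hc,
      fun h => absurd h hs⟩

theorem exists_isMarkedBasis (hss : IsStronglyStable J) (hJ : IsUnderTruncation m J)
    (hφ : KillsEquations J φ) :
    ∃ f : Exp n → Poly n A, IsMarkedFamily J (monomialBasis J) f ∧ IsMarkedBasis J f ∧
      ExtendsSpecialization φ f := by
  choose! f hf hmem hext using fun α (hα : α ∈ monomialBasis J) =>
    hφ.exists_isMarkedPoly hss hJ hα
  exact ⟨f, hf, isMarkedBasis_of_mem_superminimalSpan hJ hf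
    (fun α hα => hφ.monomial_mul_mem_superminimalSpan hss hJ hα) hmem,
    fun α hα => hext α hα.1 hα⟩

end KillsEquations

end Extension

end Bases

/-! ### The universal marked basis -/

section Universal

variable {n : ℕ} {K : Type*} [Field K] {A : Type*} [CommRing A] {J : Ideal (Poly n K)} {m : ℕ}

theorem IsMarkedBasis.congr {f f' : Exp n → Poly n A} (hb : IsMarkedBasis J f)
    (h : ∀ α ∈ monomialBasis J, f α = f' α) : IsMarkedBasis J f' := by
  rw [IsMarkedBasis, ← Set.image_congr h]
  exact hb

theorem map_inclRing_genericFamily {α : Exp n} (hα : α ∈ superminimals J) :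
    map (inclRing J : Coef J →+* MvPolynomial (ParamC J) K)
      (genericFamily J (superminimals J) α) = genericFamily J (monomialBasis J) α := by
  rw [genericFamily_of_mem hα, genericFamily_of_mem hα.1, generic, generic, map_sub, map_monomial,
    map_one, map_sum]
  refine congrArg _ (Finset.sum_congr rfl fun γ _ => ?_)
  rw [map_monomial]
  exact congrArg _ (rename_X (inclParam J) _)

theorem IsMarkedBasis.idealAt_le_ker {φ : Coef J →+* A} {f : Exp n → Poly n A}
    (hf : IsMarkedFamily J (monomialBasis J) f) (hb : IsMarkedBasis J f)
    (hext : ExtendsSpecialization φ f) : idealAt J ≤ RingHom.ker φ := by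
  set ψ := familyHom J (monomialBasis J) (φ.comp C) f with hψ
  have hψf : ∀ α ∈ monomialBasis J, map ψ (genericFamily J (monomialBasis J) α) = f α :=
    fun α hα => map_familyHom subset_rfl _ hf hα
  have hcomp : ψ.comp (inclRing J : Coef J →+* MvPolynomial (ParamC J) K) = φ := by
    refine hom_ext_of_map_genericFamily (superminimals_subset J) (fun a => ?_) fun α hα => ?_
    · simp [hψ, inclRing, familyHom]
    · rw [← map_map, map_inclRing_genericFamily hα, hψf α hα.1, hext α hα]
  intro e he
  rw [← hcomp]
  exact (hb.congr fun α hα => (hψf α hα).symm).idealA_le_ker he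

theorem KillsEquations.idealAt_le_ker (hss : IsStronglyStable J) (hJ : IsUnderTruncation m J)
    {φ : Coef J →+* A} (hφ : KillsEquations J φ) : idealAt J ≤ RingHom.ker φ := by
  obtain ⟨f, hf, hb, hext⟩ := hφ.exists_isMarkedBasis hss hJ
  exact hb.idealAt_le_ker hf hext

/-- The map `K[C̃] → K[C]/𝔄_J`, whose kernel is `𝔄̃_J`. -/
abbrev toQuotient (J : Ideal (Poly n K)) : Coef J →+* MvPolynomial (ParamC J) K ⧸ idealA J :=
  (Ideal.Quotient.mk (idealA J)).comp (inclRing J : Coef J →+* MvPolynomial (ParamC J) K)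

/-- The generic marked family over `K[C]/𝔄_J`; every marked basis is a specialization of it. -/
abbrev universalFamily (J : Ideal (Poly n K)) :
    Exp n → Poly n (MvPolynomial (ParamC J) K ⧸ idealA J) :=
  fun α => map (Ideal.Quotient.mk (idealA J)) (genericFamily J (monomialBasis J) α)

theorem isMarkedFamily_universal (J : Ideal (Poly n K)) :
    IsMarkedFamily J (monomialBasis J) (universalFamily J) :=
  (isMarkedFamily_generic subset_rfl).map _

theorem isMarkedBasis_universal (hss : IsStronglyStable J) :
    IsMarkedBasis J (universalFamily J) :=
  isMarkedBasis_of_idealA_le_ker hss (Ideal.mk_ker (I := idealA J)).ge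

theorem extendsSpecialization_universal (J : Ideal (Poly n K)) :
    ExtendsSpecialization (toQuotient J) (universalFamily J) := fun α hα => by
  rw [← map_map, map_inclRing_genericFamily hα]

theorem toQuotient_eq_zero_iff {e : Coef J} : toQuotient J e = 0 ↔ e ∈ idealAt J :=
  Ideal.Quotient.eq_zero_iff_mem

namespace IsStrongReduct

variable {t : ℕ} {R : Poly n (Coef J)}

theorem map_toQuotient (hss : IsStronglyStable J) (hJ : IsUnderTruncation m J) {α : Exp n}
    (hα : α ∈ monomialBasis J)
    (hR : IsStrongReduct J (genericSet J (superminimals J)) (monomial α 1) t R) :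
    map (toQuotient J) R =
      monomial (Finsupp.single 0 t) 1 * (monomial α 1 - universalFamily J α) := by
  rw [← X_pow_eq_monomial]
  exact (isMarkedBasis_universal hss).map_strongReduct_monomial hss hJ
    (isMarkedFamily_universal J) (extendsSpecialization_universal J) hα hR

theorem coeffs_modMonomial_mem_idealAt (hss : IsStronglyStable J) (hJ : IsUnderTruncation m J)
    {α : Exp n} (hα : α ∈ monomialBasis J)
    (hR : IsStrongReduct J (genericSet J (superminimals J)) (monomial α 1) t R) :
    ∀ c ∈ (R.modMonomial (Finsupp.single 0 t)).coeffs, c ∈ idealAt J := by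
  intro c hc
  obtain ⟨γ, -, rfl⟩ := mem_coeffs_iff.1 hc
  by_cases hle : Finsupp.single 0 t ≤ γ
  · rw [coeff_modMonomial_of_le _ hle]
    exact zero_mem _
  · rw [coeff_modMonomial_of_not_le _ hle, ← toQuotient_eq_zero_iff, ← coeff_map,
      hR.map_toQuotient hss hJ hα, coeff_monomial_mul', if_neg hle]

theorem coeffs_sPoly_mem_idealAt (hss : IsStronglyStable J) (hJ : IsUnderTruncation m J)
    {F F' : Marked n (Coef J)} (hF : F ∈ genericSet J (superminimals J))
    (hF' : F' ∈ genericSet J (superminimals J))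
    (hR : IsStrongReduct J (genericSet J (superminimals J)) (sPoly F F') t R) :
    ∀ c ∈ R.coeffs, c ∈ idealAt J := by
  have hmap := (isMarkedBasis_universal hss).map_strongReduct_sPoly hss hJ
    (extendsSpecialization_universal J) hF hF' hR
  exact fun c hc => toQuotient_eq_zero_iff.1 ((map_eq_zero_iff_coeffs _).1 hmap c hc)

end IsStrongReduct

theorem killsEquations_of_idealAt_le_ker (hss : IsStronglyStable J) (hJ : IsUnderTruncation m J)
    {φ : Coef J →+* A} (hφ : idealAt J ≤ RingHom.ker φ) : KillsEquations J φ where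
  gens α hα := by
    obtain ⟨t, R, hR⟩ := exists_isStrongReduct_genericSet hss hJ (monomial α 1)
    exact ⟨t, R, hR, fun c hc => hφ (hR.coeffs_modMonomial_mem_idealAt hss hJ hα.1 c hc)⟩
  pairs p hp := by
    obtain ⟨t, R, hR⟩ := exists_isStrongReduct_genericSet hss hJ (sPoly p.1 p.2)
    exact ⟨t, R, hR, fun c hc => hφ (hR.coeffs_sPoly_mem_idealAt hss hJ hp.1 hp.2.1 c hc)⟩

theorem toQuotient_X_mem_range (hss : IsStronglyStable J) (hJ : IsUnderTruncation m J)
    (c : ParamC J) : Ideal.Quotient.mk (idealA J) (X c) ∈ (toQuotient J).range := by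
  classical
  obtain ⟨t, R, hR⟩ := exists_isStrongReduct_genericSet hss hJ (monomial c.1.1 1)
  have hne : c.1.1 ≠ c.1.2 := fun h =>
    notMem_sousEscalierDeg c.2.1 c.1.1.degree (by nth_rewrite 2 [h]; exact c.2.2)
  -- The parameter is read off a coefficient of the superminimal reduction of its head monomial.
  refine ⟨R.coeff (Finsupp.single 0 t + c.1.2), ?_⟩
  rw [← coeff_map, hR.map_toQuotient hss hJ c.2.1, coeff_monomial_mul, one_mul, coeff_sub,
    coeff_map, coeff_generic_param subset_rfl c, map_neg, sub_neg_eq_add, coeff_monomial,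
    if_neg hne, zero_add]

theorem toQuotient_surjective (hss : IsStronglyStable J) (hJ : IsUnderTruncation m J) :
    Function.Surjective (toQuotient J) := by
  intro y
  obtain ⟨p, rfl⟩ := Ideal.Quotient.mk_surjective y
  rw [← RingHom.mem_range]
  induction p using MvPolynomial.induction_on with
  | C a => exact ⟨C a, by simp [inclRing]⟩
  | add p q hp hq =>
    rw [map_add]
    exact add_mem hp hq
  | mul_X p c hp =>
    rw [map_mul]
    exact mul_mem hp (toQuotient_X_mem_range hss hJ c)

end Universal

/-! ### Points of the marked scheme -/

section Points

variable {n : ℕ} {K : Type*} [Field K] {J : Ideal (Poly n K)} {m : ℕ}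

theorem span_range_monomial {σ : Type*} (R : Type*) [CommSemiring R] (s : Set (σ →₀ ℕ)) :
    Submodule.span R (Set.range fun γ : s => monomial (γ : σ →₀ ℕ) (1 : R)) =
      restrictSupport R s := by
  rw [restrictSupport_eq_span, Set.image_eq_range]

theorem ker_mkₐ_toLinearMap {R S : Type*} [CommSemiring R] [CommRing S] [Algebra R S]
    (I : Ideal S) : LinearMap.ker (Ideal.Quotient.mkₐ R I).toLinearMap = I.restrictScalars R :=
  Submodule.ext fun _ => Ideal.Quotient.eq_zero_iff_mem

theorem linearIndependent_mk_monomial_iff {s : Set (Exp n)} {I : Ideal (Poly n K)} :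
    LinearIndependent K (fun γ : s => Ideal.Quotient.mk I (monomial (γ : Exp n) (1 : K))) ↔
      Disjoint (restrictSupport K s) (I.restrictScalars K) := by
  have hli : LinearIndependent K fun γ : s => monomial (γ : Exp n) (1 : K) := by
    have hbasis := (basisMonomials (Fin (n + 1)) K).linearIndependent
    rw [coe_basisMonomials] at hbasis
    exact hbasis.comp _ Subtype.val_injective
  change LinearIndependent K ((Ideal.Quotient.mkₐ K I).toLinearMap ∘ _) ↔ _
  rw [← ker_mkₐ_toLinearMap, ← span_range_monomial]
  exact ⟨fun h => Submodule.range_ker_disjoint h, fun h => hli.map h⟩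

theorem span_mk_monomial_eq_top_iff {s : Set (Exp n)} {I : Ideal (Poly n K)} :
    Submodule.span K (Set.range
      fun γ : s => Ideal.Quotient.mk I (monomial (γ : Exp n) (1 : K))) = ⊤ ↔
      Codisjoint (restrictSupport K s) (I.restrictScalars K) := by
  have hrange : LinearMap.range (Ideal.Quotient.mkₐ K I).toLinearMap = ⊤ :=
    LinearMap.range_eq_top.2 Ideal.Quotient.mk_surjective
  change Submodule.span K (Set.range ((Ideal.Quotient.mkₐ K I).toLinearMap ∘
    fun γ : s => monomial (γ : Exp n) (1 : K))) = ⊤ ↔ _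
  rw [Set.range_comp, ← Submodule.map_span, span_range_monomial, ← ker_mkₐ_toLinearMap,
    LinearMap.map_eq_top_iff hrange, codisjoint_iff]

theorem mem_markedFamily_iff {I : Ideal (Poly n K)} : I ∈ markedFamily J ↔
    (∀ f ∈ I, ∀ d : ℕ, homogeneousComponent d f ∈ I) ∧
      IsCompl (restrictSupport K (sousEscalier J)) (I.restrictScalars K) := by
  rw [isCompl_iff]
  exact and_congr_right fun _ =>
    and_congr linearIndependent_mk_monomial_iff span_mk_monomial_eq_top_iff

theorem eq_zero_of_mem_markedFamily {I : Ideal (Poly n K)} (hI : I ∈ markedFamily J) {h : Poly n K}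
    (hh : h ∈ I) (hred : IsReduced J h) : h = 0 :=
  Submodule.disjoint_def.1 (mem_markedFamily_iff.1 hI).2.disjoint h hred hh

theorem eq_of_mem_markedFamily {I : Ideal (Poly n K)} (hI : I ∈ markedFamily J) {α : Exp n}
    (hα : α ∈ monomialBasis J) {p p' : Poly n K} (hp : IsMarkedPoly J α p)
    (hp' : IsMarkedPoly J α p') (h : p ∈ I) (h' : p' ∈ I) : p = p' := by
  refine sub_eq_zero.1 (eq_zero_of_mem_markedFamily hI (sub_mem h h') ?_)
  have hred {q : Poly n K} (hq : IsMarkedPoly J α q) : IsReduced J (monomial α 1 - q) := fun δ hδ =>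
    (mem_sousEscalierDeg.1 (hq.mem_sousEscalierDeg_of_mem_support_monomial_sub hα hδ)).2
  rw [← sub_sub_sub_cancel_left]
  exact isReduced_sub (hred hp') (hred hp)

attribute [local instance] MvPolynomial.gradedAlgebra in
theorem IsMarkedBasis.span_mem_markedFamily (hss : IsStronglyStable J) {f : Exp n → Poly n K}
    (hf : IsMarkedFamily J (monomialBasis J) f) (hb : IsMarkedBasis J f) :
    Ideal.span (f '' monomialBasis J) ∈ markedFamily J := by
  refine mem_markedFamily_iff.2 ⟨fun h hh d => homogeneousComponent_mem_of_mem ?_ hh d,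
    Submodule.disjoint_def.2 fun h hred hh => hb h hh hred,
    Submodule.codisjoint_iff_exists_add_eq.2 fun h => ?_⟩
  · refine Ideal.homogeneous_span _ _ ?_
    rintro _ ⟨α, hα, rfl⟩
    exact ⟨_, (hf α hα).isHomogeneous⟩
  · obtain ⟨R, hR, hred⟩ := hf.exists_reduces hss h
    exact ⟨R, h - R, hred, starSpan_le_ideal_span _ _ _ _ hR.sub_mem_span, add_sub_cancel _ _⟩

theorem exists_isMarkedPoly_of_mem_markedFamily {I : Ideal (Poly n K)} (hI : I ∈ markedFamily J)
    {α : Exp n} (hα : α ∈ monomialBasis J) : ∃ p ∈ I, IsMarkedPoly J α p := by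
  obtain ⟨hhom, hcompl⟩ := mem_markedFamily_iff.1 hI
  obtain ⟨R, g, hred, hg, heq⟩ :=
    Submodule.codisjoint_iff_exists_add_eq.1 hcompl.codisjoint (monomial α 1)
  have hcomp := hhom g hg α.degree
  rw [eq_sub_of_add_eq' heq, map_sub,
    homogeneousComponent_of_mem (isHomogeneous_monomial _ rfl), if_pos rfl] at hcomp
  refine ⟨_, hcomp, (isMarkedPoly_monomial_sub_iff hα).2 fun δ hδ => ?_⟩
  rw [mem_support_iff, coeff_homogeneousComponent] at hδ
  obtain ⟨hd, hδ⟩ := ite_ne_right_iff.1 hδ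
  exact mem_sousEscalierDeg.2 ⟨hd, hred (mem_support_iff.2 hδ)⟩

theorem exists_isMarkedBasis_of_mem_markedFamily (hss : IsStronglyStable J) {I : Ideal (Poly n K)}
    (hI : I ∈ markedFamily J) : ∃ f : Exp n → Poly n K, IsMarkedFamily J (monomialBasis J) f ∧
      IsMarkedBasis J f ∧ I = Ideal.span (f '' monomialBasis J) := by
  choose! f hfI hf using fun α (hα : α ∈ monomialBasis J) =>
    exists_isMarkedPoly_of_mem_markedFamily hI hα
  have hle : Ideal.span (f '' monomialBasis J) ≤ I := Ideal.span_le.2 (Set.forall_mem_image.2 hfI)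
  refine ⟨f, hf, fun h hh => eq_zero_of_mem_markedFamily hI (hle hh),
    le_antisymm (fun h hh => ?_) hle⟩
  obtain ⟨R, hR, hred⟩ := IsMarkedFamily.exists_reduces hss hf h
  have hsub := starSpan_le_ideal_span _ _ _ _ hR.sub_mem_span
  have hRI := sub_mem hh (hle hsub)
  rw [sub_sub_cancel] at hRI
  rwa [eq_zero_of_mem_markedFamily hI hRI hred, sub_zero] at hsub

theorem forall_specialize_mem_iff {c : ParamCt J → K} {I : Ideal (Poly n K)} :
    (∀ F ∈ genericSet J (superminimals J), specialize c F.poly ∈ I) ↔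
      ∀ α ∈ superminimals J, map (eval c) (genericFamily J (superminimals J) α) ∈ I := by
  rw [genericSet_eq]
  exact Set.forall_mem_image

theorem extendsSpecialization_iff {f : Exp n → Poly n K}
    (hf : IsMarkedFamily J (monomialBasis J) f)
    (hI : Ideal.span (f '' monomialBasis J) ∈ markedFamily J) {c : ParamCt J → K} :
    ExtendsSpecialization (eval c) f ↔ ∀ F ∈ genericSet J (superminimals J),
      specialize c F.poly ∈ Ideal.span (f '' monomialBasis J) := by
  have hfI {α : Exp n} (hα : α ∈ superminimals J) : f α ∈ Ideal.span (f '' monomialBasis J) :=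
    Ideal.subset_span ⟨α, hα.1, rfl⟩
  rw [forall_specialize_mem_iff]
  exact ⟨fun h α hα => h α hα ▸ hfI hα, fun h α hα => eq_of_mem_markedFamily hI hα.1 (hf α hα.1)
    ((isMarkedFamily_generic (superminimals_subset J) α hα).map (eval c)) (hfI hα) (h α hα)⟩

theorem existsUnique_ideal_of_zero (hss : IsStronglyStable J) (hJ : IsUnderTruncation m J)
    (c : ParamCt J → K) (hc : ∀ e ∈ idealAt J, eval c e = 0) :
    ∃! I : Ideal (Poly n K), I ∈ markedFamily J ∧
      ∀ F ∈ genericSet J (superminimals J), specialize c F.poly ∈ I := by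
  obtain ⟨f, hf, hb, hext⟩ :=
    (killsEquations_of_idealAt_le_ker hss hJ hc).exists_isMarkedBasis hss hJ
  have hmem := hb.span_mem_markedFamily hss hf
  refine ⟨_, ⟨hmem, (extendsSpecialization_iff hf hmem).1 hext⟩, ?_⟩
  rintro I ⟨hI, hc'⟩
  obtain ⟨f', hf', hb', rfl⟩ := exists_isMarkedBasis_of_mem_markedFamily hss hI
  have hext' := (extendsSpecialization_iff hf' hI).2 hc'
  rw [Set.image_congr (hb'.unique hss hJ hf' hf hb hext' hext)]

theorem existsUnique_zero_of_ideal (hss : IsStronglyStable J)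
    (I : Ideal (Poly n K)) (hI : I ∈ markedFamily J) :
    ∃! c : ParamCt J → K, (∀ e ∈ idealAt J, eval c e = 0) ∧
      ∀ F ∈ genericSet J (superminimals J), specialize c F.poly ∈ I := by
  obtain ⟨f, hf, hb, rfl⟩ := exists_isMarkedBasis_of_mem_markedFamily hss hI
  have hext : ExtendsSpecialization (eval fun p : ParamCt J => -(f p.1.1).coeff p.1.2) f :=
    fun α hα => (map_familyHom (superminimals_subset J) (RingHom.id K)
      (fun β hβ => hf β (superminimals_subset J hβ)) hα).symm
  refine ⟨_, ⟨hb.idealAt_le_ker hf hext, (extendsSpecialization_iff hf hI).1 hext⟩, ?_⟩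
  rintro c ⟨-, hc⟩
  have heq : eval c = eval fun p : ParamCt J => -(f p.1.1).coeff p.1.2 :=
    hom_ext_of_map_genericFamily (superminimals_subset J) (fun a => by rw [eval_C, eval_C])
      fun α hα => ((extendsSpecialization_iff hf hI).2 hc α hα).symm.trans (hext α hα)
  funext p
  have hX := RingHom.congr_fun heq (X p)
  rwa [eval_X, eval_X] at hX

end Points

/-! ### Termination -/

section SuperminimalReduction

variable {n : ℕ} {K : Type*} [Field K] {A : Type*} [CommRing A] {J : Ideal (Poly n K)} {m : ℕ}
  {sG : Set (Marked n A)} {f : Exp n → Poly n A} {H P : Poly n A} {t : ℕ}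

theorem StronglyReduced.nonReducible (hP : StronglyReduced J sG P) : NonReducible J sG P := by
  simpa only [pow_zero, one_mul] using hP 0

theorem StronglyReduced.X_pow_mul (hP : StronglyReduced J sG P) (s : ℕ) :
    StronglyReduced J sG (X 0 ^ s * P) := by
  intro t
  rw [← mul_assoc, ← pow_add]
  exact hP _

theorem coeff_head_eq_zero_of_nonReducible
    (hP : NonReducible J (markedSet (superminimals J) f) P) {q : Marked n A}
    (hq : q ∈ starMultiples under (underIdeal J) (superminimals J) f) : P.coeff q.head = 0 := by
  rw [NonReducible, sgStep_markedSet] at hP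
  exact coeff_head_eq_zero_of_irreducible hP hq

/-- Multiplying a strong reduct of `x_0^t' H` by a power of `x_0` gives the unique nonreducible
polynomial to which `x_0^t H` reduces. -/
theorem IsStrongReduct.stronglyReduced_of_le (hJ : IsUnderTruncation m J)
    (hf : IsMarkedFamily J (superminimals J) f) {t' : ℕ} {R : Poly n A}
    (hR : IsStrongReduct J (markedSet (superminimals J) f) H t' R) (ht : t' ≤ t)
    (hP : SGReduces J (markedSet (superminimals J) f) (X 0 ^ t * H) P)
    (hn : NonReducible J (markedSet (superminimals J) f) P) :
    StronglyReduced J (markedSet (superminimals J) f) P := by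
  have hS := hf.isReductionSystem_under hJ
  obtain ⟨hred, hstrong⟩ := hR
  replace hstrong := hstrong.X_pow_mul (t - t')
  rw [sgReduces_markedSet] at hred hP
  have hred' := hred.monomial_mul hS.restr (under_single_zero (t - t'))
  rw [← X_pow_eq_monomial, ← mul_assoc, ← pow_add, Nat.sub_add_cancel ht] at hred'
  rwa [hS.isUnitriangular.reduces_unique hP hred'
    (fun _ => coeff_head_eq_zero_of_nonReducible hn)
    (fun _ => coeff_head_eq_zero_of_nonReducible hstrong.nonReducible)]

/-- The invariant of an execution of `superminimalReduction(H, sG)`: the current exponent does not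
exceed the one of any strong reduct of `H`. -/
def IsSMRState (J : Ideal (Poly n K)) (sG : Set (Marked n A)) (H : Poly n A) (x : ℕ × Poly n A) :
    Prop :=
  SGReduces J sG (X 0 ^ x.1 * H) x.2 ∧ ∀ t R, IsStrongReduct J sG H t R → x.1 ≤ t

namespace IsSMRState

theorem init : IsSMRState J sG H (0, H) := by
  refine ⟨?_, fun _ _ _ => Nat.zero_le _⟩
  rw [pow_zero, one_mul]
  exact .refl

theorem step (hJ : IsUnderTruncation m J) (hf : IsMarkedFamily J (superminimals J) f)
    {x y : ℕ × Poly n A} (hx : IsSMRState J (markedSet (superminimals J) f) H x)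
    (hs : SMRStep J (markedSet (superminimals J) f) H x y) :
    IsSMRState J (markedSet (superminimals J) f) H y := by
  cases hs with
  | reduce _ _ _ h => exact ⟨hx.1.tail h, hx.2⟩
  | restart _ _ hn hP =>
    refine ⟨.refl, fun t' R hR => Nat.lt_of_not_le fun ht => ?_⟩
    exact hP (hR.stronglyReduced_of_le hJ hf ht hx.1 hn)

theorem isSuperminimalReduction (hx : IsSMRState J sG H (t, P)) (hP : StronglyReduced J sG P) :
    IsSuperminimalReduction J sG H t P :=
  ⟨hx.1, hP, fun t' R h h' => hx.2 t' R ⟨h, h'⟩⟩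

end IsSMRState

theorem acc_smrStep (hss : IsStronglyStable J) (hJ : IsUnderTruncation m J)
    (hf : IsMarkedFamily J (superminimals J) f) (H : Poly n A) :
    Acc (fun y x => SMRStep J (markedSet (superminimals J) f) H x y) (0, H) := by
  obtain ⟨T, R, hR⟩ := exists_isStrongReduct hss hJ hf H
  -- A restart brings the exponent closer to `T`, the other steps reduce the polynomial.
  have hwf := InvImage.wf (fun x : ℕ × Poly n A => (T - x.1, x.2))
    (Nat.lt_wfRel.wf.prod_lex (hf.isReductionSystem_under hJ).isUnitriangular.wellFounded)
  suffices h : ∀ x, IsSMRState J (markedSet (superminimals J) f) H x →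
      Acc (fun y x => SMRStep J (markedSet (superminimals J) f) H x y) x from h _ .init
  intro x
  induction x using hwf.induction with
  | _ x ih =>
    refine fun hx => ⟨_, fun y hs => ?_⟩
    have hy := hx.step hJ hf hs
    refine ih y ?_ hy
    cases hs with
    | reduce t P P' h => exact .right _ (by rwa [sgStep_markedSet] at h)
    | restart t P _ _ => exact .left _ _ (Nat.sub_succ_lt_self _ _ (hy.2 T R hR))

end SuperminimalReduction

section Termination

variable {n : ℕ} {K : Type*} [Field K] {J : Ideal (Poly n K)} {m : ℕ}

theorem acc_smrStep_genericSet (hss : IsStronglyStable J) (hJ : IsUnderTruncation m J)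
    (H : Poly n (Coef J)) :
    Acc (fun y x => SMRStep J (genericSet J (superminimals J)) H x y) (0, H) := by
  rw [genericSet_eq]
  exact acc_smrStep hss hJ (isMarkedFamily_generic (superminimals_subset J)) H

theorem genericSet_superminimals_finite (J : Ideal (Poly n K)) :
    (genericSet J (superminimals J)).Finite := by
  rw [genericSet_eq]
  exact ((monomialBasis_finite J).subset (superminimals_subset J)).image _

theorem pairsL1_finite {A : Type*} [CommRing A] (J : Ideal (Poly n K)) {sG : Set (Marked n A)}
    (hsG : sG.Finite) : (pairsL1 J sG).Finite :=
  (hsG.prod hsG).subset fun _ hp => ⟨hp.1, hp.2.1⟩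

@[elab_as_elim]
theorem finite_sdiff_singleton_induction {ι : Type*} {motive : Set ι → Prop} {s : Set ι}
    (hs : s.Finite) (remove : ∀ s, (∀ a ∈ s, motive (s \ {a})) → motive s) : motive s := by
  induction hk : s.ncard using Nat.strong_induction_on generalizing s with
  | _ k ih =>
    subst hk
    exact remove s fun a ha =>
      ih _ (Set.ncard_sdiff_singleton_lt_of_mem ha hs) (hs.subset Set.sdiff_subset) rfl

/-- Every run of the algorithm that starts at `s` is finite. -/
abbrev Terminates (J : Ideal (Poly n K)) (s : State J) : Prop :=
  Acc (fun s' s => Step J s s') s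

theorem terminates_callPair {sG : Set (Marked n (Coef J))}
    {todo : Set (Marked n (Coef J) × Marked n (Coef J))}
    {p : Marked n (Coef J) × Marked n (Coef J)}
    (hloop : ∀ Gt eqs, Terminates J ⟨Gt, sG, eqs, .loopPairs todo⟩)
    {x : ℕ × Poly n (Coef J)} (hx : Acc (fun y x => SMRStep J sG (sPoly p.1 p.2) x y) x)
    (Gt : Set (Marked n (Coef J))) (eqs : Set (Coef J)) :
    Terminates J ⟨Gt, sG, eqs, .callPair todo p x.1 x.2⟩ := by
  induction hx with
  | intro x _ ih =>
    refine ⟨_, fun s hs => ?_⟩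
    cases hs with
    | pairWork _ _ _ _ _ _ t' _ P' h => exact ih (t', P') h
    | pairReturn => exact hloop _ _

theorem terminates_callGen {sG : Set (Marked n (Coef J))} {todo : Set (Exp n)} {α : Exp n}
    (hloop : ∀ Gt eqs, Terminates J ⟨Gt, sG, eqs, .loopGens todo⟩)
    {x : ℕ × Poly n (Coef J)} (hx : Acc (fun y x => SMRStep J sG (monomial α 1) x y) x)
    (Gt : Set (Marked n (Coef J))) (eqs : Set (Coef J)) :
    Terminates J ⟨Gt, sG, eqs, .callGen todo α x.1 x.2⟩ := by
  induction hx with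
  | intro x _ ih =>
    refine ⟨_, fun s hs => ?_⟩
    cases hs with
    | genWork _ _ _ _ _ _ t' _ P' h => exact ih (t', P') h
    | genReturn => exact hloop _ _

theorem terminates_loopPairs (hss : IsStronglyStable J) (hJ : IsUnderTruncation m J)
    {todo : Set (Marked n (Coef J) × Marked n (Coef J))} (hfin : todo.Finite) :
    ∀ Gt eqs, Terminates J ⟨Gt, genericSet J (superminimals J), eqs, .loopPairs todo⟩ := by
  refine finite_sdiff_singleton_induction hfin fun todo ih Gt eqs => ⟨_, fun s hs => ?_⟩
  cases hs with
  | pairCall _ _ _ _ p hp =>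
    exact terminates_callPair (ih p hp) (acc_smrStep_genericSet hss hJ _) Gt eqs
  | pairsDone => exact ⟨_, fun _ hs => nomatch hs⟩

theorem terminates_loopGens (hss : IsStronglyStable J) (hJ : IsUnderTruncation m J)
    {todo : Set (Exp n)} (hfin : todo.Finite) :
    ∀ Gt eqs, Terminates J ⟨Gt, genericSet J (superminimals J), eqs, .loopGens todo⟩ := by
  refine finite_sdiff_singleton_induction hfin fun todo ih Gt eqs => ⟨_, fun s hs => ?_⟩
  cases hs with
  | genCall _ _ _ _ α hα =>
    exact terminates_callGen (ih α hα) (acc_smrStep_genericSet hss hJ _) Gt eqs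
  | gensDone =>
    exact terminates_loopPairs hss hJ (pairsL1_finite J (genericSet_superminimals_finite J)) Gt eqs

/-- The generic polynomials that have been built when the elements of `todo` are left. -/
def builtSet (J : Ideal (Poly n K)) (todo : Set (Exp n)) : Set (Marked n (Coef J)) :=
  {F | ∃ (α : Exp n) (hα : α ∈ superminimals J), α ∉ todo ∧ F = generic J (superminimals J) α hα}

theorem builtSet_empty (J : Ideal (Poly n K)) :
    builtSet J ∅ = genericSet J (superminimals J) := by
  simp only [builtSet, genericSet, Set.mem_empty_iff_false, not_false_eq_true, true_and]

theorem builtSet_superminimals (J : Ideal (Poly n K)) : builtSet J (superminimals J) = ∅ :=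
  Set.eq_empty_of_forall_notMem fun _ ⟨_, hα, hn, _⟩ => hn hα

theorem insert_builtSet {todo : Set (Exp n)} {α : Exp n} (hα : α ∈ superminimals J) :
    insert (generic J (superminimals J) α hα) (builtSet J todo) = builtSet J (todo \ {α}) := by
  ext F
  constructor
  · rintro (rfl | ⟨β, hβ, h, rfl⟩)
    · exact ⟨α, hα, fun h => h.2 rfl, rfl⟩
    · exact ⟨β, hβ, fun h' => h h'.1, rfl⟩
  · rintro ⟨β, hβ, h, rfl⟩
    by_cases he : β = α
    · subst he
      exact Or.inl rfl
    · exact Or.inr ⟨β, hβ, fun h' => h ⟨h', he⟩, rfl⟩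

theorem terminates_build (hss : IsStronglyStable J) (hJ : IsUnderTruncation m J)
    {todo : Set (Exp n)} (hfin : todo.Finite) :
    ∀ Gt eqs, Terminates J ⟨Gt, builtSet J todo, eqs, .build todo⟩ := by
  refine finite_sdiff_singleton_induction hfin fun todo ih Gt eqs => ⟨_, fun s hs => ?_⟩
  cases hs with
  | build _ _ _ _ α hα hmem =>
    rw [insert_builtSet hα]
    exact ih α hmem _ _
  | buildDone =>
    rw [builtSet_empty]
    exact terminates_loopGens hss hJ ((monomialBasis_finite J).subset Set.sdiff_subset) _ _

theorem terminates_initState (hss : IsStronglyStable J) (hJ : IsUnderTruncation m J) :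
    Terminates J (initState J) := by
  have hfin := (monomialBasis_finite J).subset (superminimals_subset J)
  have hbuild := terminates_build hss hJ hfin ∅ ∅
  rwa [builtSet_superminimals] at hbuild

end Termination

/-! ### The invariant of the algorithm -/

section Invariants

variable {n : ℕ} {K : Type*} [Field K] {J : Ideal (Poly n K)} {m : ℕ}
  {eqs eqs' : Set (Coef J)} {α : Exp n} {p : Marked n (Coef J) × Marked n (Coef J)}

/-- `eqs` contains the equations that some superminimal reduction of `x^α` yields. -/
def GenProcessed (eqs : Set (Coef J)) (α : Exp n) : Prop :=
  ∃ t R, IsStrongReduct J (genericSet J (superminimals J)) (monomial α 1) t R ∧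
    ((R.modMonomial (Finsupp.single 0 t)).coeffs : Set (Coef J)) ⊆ eqs

/-- `eqs` contains the equations that some superminimal reduction of the S-polynomial of the pair
`p` yields. -/
def PairProcessed (eqs : Set (Coef J)) (p : Marked n (Coef J) × Marked n (Coef J)) : Prop :=
  ∃ t R, IsStrongReduct J (genericSet J (superminimals J)) (sPoly p.1 p.2) t R ∧
    (R.coeffs : Set (Coef J)) ⊆ eqs

theorem GenProcessed.mono (h : GenProcessed eqs α) (hle : eqs ⊆ eqs') : GenProcessed eqs' α :=
  let ⟨t, R, hR, hc⟩ := h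
  ⟨t, R, hR, hc.trans hle⟩

theorem PairProcessed.mono (h : PairProcessed eqs p) (hle : eqs ⊆ eqs') : PairProcessed eqs' p :=
  let ⟨t, R, hR, hc⟩ := h
  ⟨t, R, hR, hc.trans hle⟩

/-- The equations found while the elements of `todo` are left in the loop over `B_J \ sB_J`. -/
structure GensInvariant (J : Ideal (Poly n K)) (eqs : Set (Coef J)) (todo : Set (Exp n)) :
    Prop where
  finite : eqs.Finite
  todo_subset : todo ⊆ monomialBasis J \ superminimals J
  sound : eqs ⊆ idealAt J
  gens : ∀ α ∈ (monomialBasis J \ superminimals J) \ todo, GenProcessed eqs α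

/-- The equations found while the elements of `todo` are left in the loop over `L_1`. -/
structure PairsInvariant (J : Ideal (Poly n K)) (eqs : Set (Coef J))
    (todo : Set (Marked n (Coef J) × Marked n (Coef J))) : Prop extends
    GensInvariant J eqs ∅ where
  pairs_subset : todo ⊆ pairsL1 J (genericSet J (superminimals J))
  pairs : ∀ p ∈ pairsL1 J (genericSet J (superminimals J)) \ todo, PairProcessed eqs p

/-- The invariant of the algorithm `markedScheme`, at each of its program points. -/
inductive Invariant (J : Ideal (Poly n K)) : State J → Prop
  | build {Gt todo} (hsub : todo ⊆ superminimals J) :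
      Invariant J ⟨Gt, builtSet J todo, ∅, .build todo⟩
  | loopGens {Gt eqs todo} (hinv : GensInvariant J eqs todo) :
      Invariant J ⟨Gt, genericSet J (superminimals J), eqs, .loopGens todo⟩
  | callGen {Gt eqs todo α t P} (hinv : GensInvariant J eqs (insert α todo))
      (hst : IsSMRState J (genericSet J (superminimals J)) (monomial α 1) (t, P)) :
      Invariant J ⟨Gt, genericSet J (superminimals J), eqs, .callGen todo α t P⟩
  | loopPairs {Gt eqs todo} (hinv : PairsInvariant J eqs todo) :
      Invariant J ⟨Gt, genericSet J (superminimals J), eqs, .loopPairs todo⟩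
  | callPair {Gt eqs todo p t P} (hinv : PairsInvariant J eqs (insert p todo))
      (hst : IsSMRState J (genericSet J (superminimals J)) (sPoly p.1 p.2) (t, P)) :
      Invariant J ⟨Gt, genericSet J (superminimals J), eqs, .callPair todo p t P⟩
  | returned {Gt eqs} (hinv : PairsInvariant J eqs ∅) :
      Invariant J ⟨Gt, genericSet J (superminimals J), eqs, .returned⟩

theorem IsSMRState.step_genericSet (hJ : IsUnderTruncation m J) {H : Poly n (Coef J)}
    {x y : ℕ × Poly n (Coef J)} (hx : IsSMRState J (genericSet J (superminimals J)) H x)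
    (hs : SMRStep J (genericSet J (superminimals J)) H x y) :
    IsSMRState J (genericSet J (superminimals J)) H y := by
  rw [genericSet_eq] at *
  exact hx.step hJ (isMarkedFamily_generic (superminimals_subset J)) hs

theorem GensInvariant.init (J : Ideal (Poly n K)) :
    GensInvariant J ∅ (monomialBasis J \ superminimals J) where
  finite := Set.finite_empty
  todo_subset := subset_rfl
  sound := Set.empty_subset _
  gens _ hα := absurd hα.1 hα.2

theorem GensInvariant.pairsInvariant (h : GensInvariant J eqs ∅) :
    PairsInvariant J eqs (pairsL1 J (genericSet J (superminimals J))) where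
  toGensInvariant := h
  pairs_subset := subset_rfl
  pairs _ hp := absurd hp.1 hp.2

theorem GensInvariant.insert_return (hss : IsStronglyStable J) (hJ : IsUnderTruncation m J)
    {todo : Set (Exp n)} (h : GensInvariant J eqs (insert α todo)) {t : ℕ} {R : Poly n (Coef J)}
    (hR : IsStrongReduct J (genericSet J (superminimals J)) (monomial α 1) t R) :
    GensInvariant J (eqs ∪ (R.modMonomial (Finsupp.single 0 t)).coeffs) todo where
  finite := h.finite.union (Finset.finite_toSet _)
  todo_subset := (Set.subset_insert _ _).trans h.todo_subset
  sound := Set.union_subset h.sound <|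
    hR.coeffs_modMonomial_mem_idealAt hss hJ (h.todo_subset (Set.mem_insert _ _)).1
  gens β hβ := by
    by_cases he : β = α
    · subst he
      exact ⟨t, R, hR, Set.subset_union_right⟩
    · exact (h.gens β ⟨hβ.1, fun hm => hm.elim he hβ.2⟩).mono Set.subset_union_left

theorem PairsInvariant.insert_return (hss : IsStronglyStable J) (hJ : IsUnderTruncation m J)
    {todo : Set (Marked n (Coef J) × Marked n (Coef J))}
    (h : PairsInvariant J eqs (insert p todo)) {t : ℕ} {R : Poly n (Coef J)}
    (hR : IsStrongReduct J (genericSet J (superminimals J)) (sPoly p.1 p.2) t R) :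
    PairsInvariant J (eqs ∪ R.coeffs) todo where
  finite := h.finite.union (Finset.finite_toSet _)
  todo_subset := Set.empty_subset _
  sound :=
    have hp := h.pairs_subset (Set.mem_insert _ _)
    Set.union_subset h.sound (hR.coeffs_sPoly_mem_idealAt hss hJ hp.1 hp.2.1)
  gens α hα := (h.gens α hα).mono Set.subset_union_left
  pairs_subset := (Set.subset_insert _ _).trans h.pairs_subset
  pairs q hq := by
    by_cases he : q = p
    · subst he
      exact ⟨t, R, hR, Set.subset_union_right⟩
    · exact (h.pairs q ⟨hq.1, fun hm => hm.elim he hq.2⟩).mono Set.subset_union_left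

theorem Invariant.step (hss : IsStronglyStable J) (hJ : IsUnderTruncation m J) {s s' : State J}
    (h : Invariant J s) (hs : Step J s s') : Invariant J s' := by
  cases hs with
  | build _ _ _ _ α hα _ =>
    let .build hsub := h
    rw [insert_builtSet hα]
    exact .build (Set.sdiff_subset.trans hsub)
  | buildDone =>
    cases h
    rw [builtSet_empty]
    exact .loopGens (.init J)
  | genCall _ _ _ _ α hmem =>
    let .loopGens hinv := h
    refine .callGen ?_ .init
    rwa [Set.insert_sdiff_singleton, Set.insert_eq_of_mem hmem]
  | genWork _ _ _ _ _ _ _ _ _ hs =>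
    let .callGen hinv hst := h
    exact .callGen hinv (hst.step_genericSet hJ hs)
  | genReturn _ _ _ _ _ _ _ hred =>
    let .callGen hinv hst := h
    exact .loopGens (hinv.insert_return hss hJ ⟨hst.1, hred⟩)
  | gensDone =>
    let .loopGens hinv := h
    exact .loopPairs hinv.pairsInvariant
  | pairCall _ _ _ _ p hmem =>
    let .loopPairs hinv := h
    refine .callPair ?_ .init
    rwa [Set.insert_sdiff_singleton, Set.insert_eq_of_mem hmem]
  | pairWork _ _ _ _ _ _ _ _ _ hs =>
    let .callPair hinv hst := h
    exact .callPair hinv (hst.step_genericSet hJ hs)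
  | pairReturn _ _ _ _ _ _ _ hred =>
    let .callPair hinv hst := h
    exact .loopPairs (hinv.insert_return hss hJ ⟨hst.1, hred⟩)
  | pairsDone =>
    let .loopPairs hinv := h
    exact .returned hinv

theorem Reachable.invariant (hss : IsStronglyStable J) (hJ : IsUnderTruncation m J) {s : State J}
    (h : Reachable J s) : Invariant J s := by
  induction h with
  | refl =>
    rw [initState]
    nth_rewrite 2 [← builtSet_superminimals J]
    exact .build subset_rfl
  | tail _ hs ih => exact ih.step hss hJ hs

theorem exists_smrStep {A : Type*} [CommRing A] {sG : Set (Marked n A)} {H P : Poly n A} {t : ℕ}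
    (hP : ¬ StronglyReduced J sG P) : ∃ t' P', SMRStep J sG H (t, P) (t', P') := by
  by_cases hn : NonReducible J sG P
  · exact ⟨_, _, .restart t P hn hP⟩
  · rw [NonReducible] at hn
    push Not at hn
    obtain ⟨P', h⟩ := hn
    exact ⟨_, _, .reduce t P P' h⟩

theorem Invariant.exists_step {s : State J} (h : Invariant J s) (hr : s.ctrl ≠ .returned) :
    ∃ s', Step J s s' := by
  cases h with
  | @build _ todo hsub =>
    rcases todo.eq_empty_or_nonempty with rfl | ⟨α, hα⟩
    · exact ⟨_, .buildDone ..⟩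
    · exact ⟨_, .build (hα := hsub hα) (h := hα) ..⟩
  | @loopGens _ _ todo =>
    rcases todo.eq_empty_or_nonempty with rfl | ⟨α, hα⟩
    · exact ⟨_, .gensDone ..⟩
    · exact ⟨_, .genCall (h := hα) ..⟩
  | @callGen _ _ _ _ _ P =>
    by_cases hP : StronglyReduced J (genericSet J (superminimals J)) P
    · exact ⟨_, .genReturn (h := hP) ..⟩
    · obtain ⟨_, _, hs⟩ := exists_smrStep hP
      exact ⟨_, .genWork (h := hs) ..⟩
  | @loopPairs _ _ todo =>
    rcases todo.eq_empty_or_nonempty with rfl | ⟨p, hp⟩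
    · exact ⟨_, .pairsDone ..⟩
    · exact ⟨_, .pairCall (h := hp) ..⟩
  | @callPair _ _ _ _ _ P =>
    by_cases hP : StronglyReduced J (genericSet J (superminimals J)) P
    · exact ⟨_, .pairReturn (h := hP) ..⟩
    · obtain ⟨_, _, hs⟩ := exists_smrStep hP
      exact ⟨_, .pairWork (h := hs) ..⟩
  | returned => exact absurd rfl hr

theorem PairsInvariant.span_eq (hss : IsStronglyStable J) (hJ : IsUnderTruncation m J)
    (h : PairsInvariant J eqs ∅) : Ideal.span eqs = idealAt J := by
  refine le_antisymm (Ideal.span_le.2 h.sound) ?_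
  have hker : ∀ c ∈ eqs, Ideal.Quotient.mk (Ideal.span eqs) c = 0 := fun c hc =>
    Ideal.Quotient.eq_zero_iff_mem.2 (Ideal.subset_span hc)
  have hkills : KillsEquations J (Ideal.Quotient.mk (Ideal.span eqs)) :=
    { gens := fun α hα =>
        let ⟨t, R, hR, hc⟩ := h.gens α ⟨hα, Set.notMem_empty _⟩
        ⟨t, R, hR, fun c hc' => hker c (hc hc')⟩
      pairs := fun p hp =>
        let ⟨t, R, hR, hc⟩ := h.pairs p ⟨hp, Set.notMem_empty _⟩
        ⟨t, R, hR, fun c hc' => hker c (hc hc')⟩ }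
  exact (hkills.idealAt_le_ker hss hJ).trans_eq Ideal.mk_ker

end Invariants

end MarkedScheme

end

open MarkedScheme

theorem mainTheorem11 {K : Type*} [Field K] {n : ℕ} (m : ℕ)
    (J : Ideal (MvPolynomial (Fin (n + 1)) K))
    (hmon : IsMonomialIdeal J) (hss : IsStronglyStable J) (htr : IsTruncation m J) :
    -- termination: there is no infinite run, and a run can only stop by returning
    (¬ ∃ run : ℕ → State J, run 0 = initState J ∧ ∀ k, Step J (run k) (run (k + 1))) ∧
    (∀ s, Reachable J s → s.ctrl ≠ .returned → ∃ s', Step J s s') ∧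
    -- the calls of superminimal reduction end with the prescribed values
    (∀ Gt sG eqs todo α t H, Reachable J ⟨Gt, sG, eqs, .callGen todo α t H⟩ →
      StronglyReduced J sG H → IsSuperminimalReduction J sG (monomial α 1) t H) ∧
    (∀ Gt sG eqs todo p t H, Reachable J ⟨Gt, sG, eqs, .callPair todo p t H⟩ →
      StronglyReduced J sG H → IsSuperminimalReduction J sG (sPoly p.1 p.2) t H) ∧
    -- whatever is returned is a finite set of generators of the ideal that defines `Mf(J)`
    (∀ Gt sG eqs, Reachable J ⟨Gt, sG, eqs, .returned⟩ →
      eqs.Finite ∧ Ideal.span eqs = idealAt J) ∧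
    -- the scheme defined by `idealAt J` is the one defined by `idealA J`, via projection
    Function.Surjective
      ((Ideal.Quotient.mk (idealA J)).comp (inclRing J : Coef J →+* MvPolynomial (ParamC J) K)) ∧
    -- its `K`-points correspond one-to-one to the ideals of `Mf(J)`
    (∀ c : ParamCt J → K, (∀ e ∈ idealAt J, MvPolynomial.eval c e = 0) →
      ∃! I : Ideal (MvPolynomial (Fin (n + 1)) K), I ∈ markedFamily J ∧
        ∀ F ∈ genericSet J (superminimals J), specialize c F.poly ∈ I) ∧
    (∀ I ∈ markedFamily J, ∃! c : ParamCt J → K,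
      (∀ e ∈ idealAt J, MvPolynomial.eval c e = 0) ∧
        ∀ F ∈ genericSet J (superminimals J), specialize c F.poly ∈ I) := by
  have hJ := htr.isUnderTruncation hss
  refine ⟨fun hrun => not_acc_iff_exists_descending_chain.2 hrun (terminates_initState hss hJ),
    fun s hs => (hs.invariant hss hJ).exists_step, fun _ _ _ _ _ _ _ hs hred => ?_,
    fun _ _ _ _ _ _ _ hs hred => ?_, fun _ _ _ hs => ?_, toQuotient_surjective hss hJ,
    existsUnique_ideal_of_zero hss hJ, existsUnique_zero_of_ideal hss⟩
  · let .callGen _ hst := hs.invariant hss hJ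
    exact hst.isSuperminimalReduction hred
  · let .callPair _ hst := hs.invariant hss hJ
    exact hst.isSuperminimalReduction hred
  · let .returned hinv := hs.invariant hss hJ
    exact ⟨hinv.finite, hinv.span_eq hss hJ⟩
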